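/- Fix infinite sets of node ids, edge ids and variables, sets of labels, keys and (linearly ordered) constants, and two distinct labels $\mathit{first}$, $\mathit{last}$. For $n\ge 0$ a \emph{dataless path of length $n$} is a property graph with distinct nodes $v_0,\dots,v_n$, distinct edges $e_i$ from $v_i$ to $v_{i+1}$ ($0\le i<n$), the label $\mathit{first}$ on $v_0$, the label $\mathit{last}$ on $v_n$, no other labels and no property values. Path patterns are given by $\psi ::= (x) \mid \overset{x}{\rightarrow} \mid \overset{x}{\leftarrow} \mid \psi_1\psi_2 \mid \psi^{n..m} \mid \psi\langle\theta\rangle \mid \psi_1+\psi_2$ (variables $x$ optional, $0\le n\le m\le\infty$, repeated patterns have no free variables, the two sides of $+$ have the same free variables, $\theta$ a Boolean combination of conditions $x.k=x'.k'$, $x.k<x'.k'$, $\ell(x)$). A pattern with output $\psi_\Omega$ returns the relation of the values of the listed variables $x$ and properties $x.k$ over all matches of $\psi$. \emph{Core PGQ} is relational algebra, and \emph{Core GQL} is linear composition relational algebra (linear clauses $S,\pi_A,\sigma_\theta,\rho_{A\to A'},\mathbf L\,\mathbf L',\{\mathcal Q\}$ that map driving tables to tables, and queries closed under $\cup,\cap,\setminus$,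 evaluated on the table holding just the empty tuple), both over the relations $\psi_\Omega$. A Core GQL or Core PGQ query is true on a graph if its result is nonempty. For relational languages a property graph is represented by the relations of all nodes, of all pairs $(u,v)$ joined by an edge, and, for each label $\ell$, of all $\ell$-labeled nodes and of all pairs joined by an $\ell$-labeled edge. \emph{Linear Datalog} consists of the Datalog programs in which each rule body has at most one occurrence of an IDB atom. \emph{Positive recursive SQL} consists of sequences of recursive common table expressions followed by a main query, each a union of select-from-where blocks whose where-clauses are conjunctions of equalities of columns, a recursively defined table occurring at most once in each from-clause of its definition. \textbf{Theorem.} (1) There is a Boolean query $q$ on property graphs such that, on every dataless path of length $n\ge 0$, $q$ is true if and only if $n=2^k$ for some $k\in\mathbb N$, and such that $q$ is expressible (on all property graphs) in positive recursive SQL and in linear Datalog, but neither in Core GQL nor in Core PGQ. (2) There is no Core GQL query, and no Core PGQ query, that for every $n\ge 1$ is true on a dataless path of length $n$ if and only if $n=2^k$ for some $k\in\mathbb N$. (3) For every Core GQL query and every Core PGQ query $\mathcal Q$ there is a set $A\subseteq\mathbb N$, definable in Presburger arithmetic (hence semilinear, hence ultimately periodic: there are $t\ge 0$ and $p\ge 1$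 with $n\in A\Leftrightarrow n+p\in A$ for all $n>t$), such that for every $n\ge 1$ and every dataless path $P$ of length $n$, $\mathcal Q$ is true on $P$ if and only if $n\in A$. -/

import Mathlib

universe u w

namespace GraphQL

open scoped Classical

noncomputable section

/-! ## Tuples in the named perspective -/

/-- A tuple: a partial map from attributes to values (`none` means that the attribute is not in the
domain). A relation is a set of such tuples. -/
abbrev Tuple (A U : Type*) := A → Option U

namespace Tuple

variable {A U : Type*}

/-- The tuple with empty domain. -/
def nil : Tuple A U := fun _ => none

/-- The tuple `{x ↦ u}`; for an omitted variable it is the empty tuple. -/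
def bind (x : Option A) (u : U) : Tuple A U := fun a => if x = some a then some u else none

/-- The domain of a tuple. -/
def dom (μ : Tuple A U) : Set A := {a | μ a ≠ none}

/-- Two tuples are compatible if they agree on their common attributes. -/
def Compatible (μ ν : Tuple A U) : Prop := ∀ a ∈ μ.dom ∩ ν.dom, μ a = ν a

/-- The join of two (compatible) tuples. -/
def join (μ ν : Tuple A U) : Tuple A U := fun a => if a ∈ μ.dom then μ a else ν a

/-- The restriction of a tuple to a set of attributes. -/
def restrict (μ : Tuple A U) (S : Set A) : Tuple A U := fun a => if a ∈ S then μ a else none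

/-- The renaming of `a` to `b`; a tuple whose domain contains neither of them is unchanged. -/
def rename (a b : A) (μ : Tuple A U) : Tuple A U :=
  fun c => if c = b then μ a else if c = a then none else μ c

/-- The natural join of two relations. -/
def natJoin (R S : Set (Tuple A U)) : Set (Tuple A U) :=
  {τ | ∃ μ ∈ R, ∃ ν ∈ S, μ.Compatible ν ∧ τ = μ.join ν}

end Tuple

/-! ## Relational algebra and linear composition relational algebra

Both are over relation symbols from `S`; the relation symbol `s` has the set of attributes `sch s`
and the database `D` assigns a relation to each symbol. -/

/-- Selection conditions. -/
inductive SelCond (A : Type*)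
  | eq (a b : A)
  | not (θ : SelCond A)
  | or (θ θ' : SelCond A)
  | and (θ θ' : SelCond A)

/-- Satisfaction of a selection condition by a tuple. -/
def SelCond.Holds {A U : Type*} (μ : Tuple A U) : SelCond A → Prop
  | .eq a b => a ∈ μ.dom ∧ b ∈ μ.dom ∧ μ a = μ b
  | .not θ => ¬ θ.Holds μ
  | .or θ θ' => θ.Holds μ ∨ θ'.Holds μ
  | .and θ θ' => θ.Holds μ ∧ θ'.Holds μ

/-- Raw expressions of relational algebra. -/
inductive RA (S A : Type*)
  | rel (s : S)
  | proj (B : Set A) (Q : RA S A)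
  | sel (θ : SelCond A) (Q : RA S A)
  | ren (a b : A) (Q : RA S A)
  | join (Q Q' : RA S A)
  | union (Q Q' : RA S A)
  | inter (Q Q' : RA S A)
  | diff (Q Q' : RA S A)

namespace RA

variable {S A U : Type*}

/-- The attributes of an expression. -/
def attr (sch : S → Set A) : RA S A → Set A
  | rel s => sch s
  | proj B _ => B
  | sel _ Q => Q.attr sch
  | ren a b Q => (Q.attr sch \ {a}) ∪ {b}
  | join Q Q' => Q.attr sch ∪ Q'.attr sch
  | union Q _ => Q.attr sch
  | inter Q _ => Q.attr sch
  | diff Q _ => Q.attr sch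

/-- The typing side conditions of relational algebra. -/
def WellFormed (sch : S → Set A) : RA S A → Prop
  | rel _ => True
  | proj B Q => Q.WellFormed sch ∧ B ⊆ Q.attr sch
  | sel _ Q => Q.WellFormed sch
  | ren a b Q => Q.WellFormed sch ∧ a ∈ Q.attr sch ∧ b ∉ Q.attr sch
  | join Q Q' => Q.WellFormed sch ∧ Q'.WellFormed sch
  | union Q Q' => Q.WellFormed sch ∧ Q'.WellFormed sch ∧ Q.attr sch = Q'.attr sch
  | inter Q Q' => Q.WellFormed sch ∧ Q'.WellFormed sch ∧ Q.attr sch = Q'.attr sch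
  | diff Q Q' => Q.WellFormed sch ∧ Q'.WellFormed sch ∧ Q.attr sch = Q'.attr sch

/-- The semantics of relational algebra. -/
def eval (D : S → Set (Tuple A U)) : RA S A → Set (Tuple A U)
  | rel s => D s
  | proj B Q => (fun μ => μ.restrict B) '' Q.eval D
  | sel θ Q => {μ ∈ Q.eval D | θ.Holds μ}
  | ren a b Q => Tuple.rename a b '' Q.eval D
  | join Q Q' => Tuple.natJoin (Q.eval D) (Q'.eval D)
  | union Q Q' => Q.eval D ∪ Q'.eval D
  | inter Q Q' => Q.eval D ∩ Q'.eval D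
  | diff Q Q' => Q.eval D \ Q'.eval D

end RA

mutual

/-- Linear clauses of linear composition relational algebra. -/
inductive LCRA.Clause (S : Type u) (A : Type w)
  | rel (s : S)
  | proj (B : Set A)
  | sel (θ : SelCond A)
  | ren (a b : A)
  | seq (L L' : LCRA.Clause S A)
  | call (Q : LCRA.Query S A)

/-- Queries of linear composition relational algebra. -/
inductive LCRA.Query (S : Type u) (A : Type w)
  | clause (L : LCRA.Clause S A)
  | inter (Q Q' : LCRA.Query S A)
  | union (Q Q' : LCRA.Query S A)
  | diff (Q Q' : LCRA.Query S A)

end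

mutual

/-- The semantics of a linear clause: a map from driving tables to tables. On the tuples of a
table with attributes `B'`, restricting to `B` and to `B ∩ B'` is the same. -/
def LCRA.Clause.eval {S A U : Type*} (D : S → Set (Tuple A U)) :
    LCRA.Clause S A → Set (Tuple A U) → Set (Tuple A U)
  | .rel s, R => Tuple.natJoin R (D s)
  | .proj B, R => (fun μ => μ.restrict B) '' R
  | .sel θ, R => {μ ∈ R | θ.Holds μ}
  | .ren a b, R => Tuple.rename a b '' {μ ∈ R | b ∉ μ.dom}
  | .seq L L', R => L'.eval D (L.eval D R)
  | .call Q, R => Tuple.natJoin R (Q.eval D R)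

/-- The semantics of a query: a map from driving tables to tables. -/
def LCRA.Query.eval {S A U : Type*} (D : S → Set (Tuple A U)) :
    LCRA.Query S A → Set (Tuple A U) → Set (Tuple A U)
  | .clause L, R => L.eval D R
  | .inter Q Q', R => Q.eval D R ∩ Q'.eval D R
  | .union Q Q', R => Q.eval D R ∪ Q'.eval D R
  | .diff Q Q', R => Q.eval D R \ Q'.eval D R

end

/-- The output of a query: its value on the driving table holding just the empty tuple. -/
def LCRA.Query.output {S A U : Type*} (Q : LCRA.Query S A) (D : S → Set (Tuple A U)) :
    Set (Tuple A U) :=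
  Q.eval D {Tuple.nil}

/-! ## Property graphs

`N`, `E`, `L`, `K`, `C` are the sets of node ids, edge ids, labels, keys and constants. -/

/-- A property graph. The values of `src` and `tgt` off `edges`, and of `lab` and `prop` off the
nodes and edges of the graph, carry no information and are never used. -/
structure PropertyGraph (N E L K C : Type*) where
  nodes : Finset N
  edges : Finset E
  lab : N ⊕ E → Finset L
  src : E → N
  tgt : E → N
  prop : N ⊕ E → K → Option C
  src_mem : ∀ e ∈ edges, src e ∈ nodes
  tgt_mem : ∀ e ∈ edges, tgt e ∈ nodes

/-- Values: node ids, edge ids and constants. -/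
inductive Value (N E C : Type*)
  | node (n : N)
  | edge (e : E)
  | const (c : C)

/-- An alternating sequence `u₀ e₁ u₁ ⋯ eₙ uₙ` of nodes and edges, with `start = u₀` and
`steps = [(e₁, u₁), …, (eₙ, uₙ)]`. -/
structure GPath (N E : Type*) where
  start : N
  steps : List (E × N)

namespace GPath

variable {N E : Type*}

/-- The path with a single node. -/
def single (n : N) : GPath N E := ⟨n, []⟩

/-- The last node of a path. -/
def last (p : GPath N E) : N := (p.steps.map Prod.snd).getLastD p.start

/-- Two paths concatenate if the first ends where the second starts. -/
def Concatenates (p q : GPath N E) : Prop := p.last = q.start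

/-- The concatenation of two paths. -/
def append (p q : GPath N E) : GPath N E := ⟨p.start, p.steps ++ q.steps⟩

end GPath

/-! ## Patterns -/

/-- Conditions in patterns. -/
inductive PatCond (V L K : Type*)
  | eq (x : V) (k : K) (x' : V) (k' : K)
  | lt (x : V) (k : K) (x' : V) (k' : K)
  | label (l : L) (x : V)
  | or (θ θ' : PatCond V L K)
  | and (θ θ' : PatCond V L K)
  | not (θ : PatCond V L K)

/-- Path patterns; the variables in node and edge patterns are optional. -/
inductive Pattern (V L K : Type*)
  | node (x : Option V)
  | fwd (x : Option V)
  | bwd (x : Option V)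
  | concat (ψ ψ' : Pattern V L K)
  | rep (ψ : Pattern V L K) (n : ℕ) (m : ℕ∞)
  | cond (ψ : Pattern V L K) (θ : PatCond V L K)
  | union (ψ ψ' : Pattern V L K)

/-- Items that a pattern may return: variables `x` and properties `x.k`. -/
inductive OutItem (V K : Type*)
  | var (x : V)
  | prop (x : V) (k : K)

/-- The variable present in an output item. -/
def OutItem.base {V K : Type*} : OutItem V K → V
  | var x => x
  | prop x _ => x

/-- Attributes: all output items, and infinitely many further names. -/
inductive Attr (V K : Type*)
  | out (o : OutItem V K)
  | name (i : ℕ)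

section Semantics

variable {V N E L K C : Type*}

/-- The free variables of a pattern. -/
def Pattern.fv : Pattern V L K → Set V
  | .node x => {y | x = some y}
  | .fwd x => {y | x = some y}
  | .bwd x => {y | x = some y}
  | .concat ψ ψ' => ψ.fv ∪ ψ'.fv
  | .rep _ _ _ => ∅
  | .cond ψ _ => ψ.fv
  | .union ψ _ => ψ.fv

/-- The side conditions in the grammar of patterns. -/
def Pattern.WellFormed : Pattern V L K → Prop
  | .node _ => True
  | .fwd _ => True
  | .bwd _ => True
  | .concat ψ ψ' => ψ.WellFormed ∧ ψ'.WellFormed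
  | .rep ψ n m => ψ.WellFormed ∧ (n : ℕ∞) ≤ m
  | .cond ψ _ => ψ.WellFormed
  | .union ψ ψ' => ψ.WellFormed ∧ ψ'.WellFormed ∧ ψ.fv = ψ'.fv

/-- `prop(u, k)`, a partial function; constants have no properties. -/
def PropertyGraph.valueProp (G : PropertyGraph N E L K C) : Value N E C → K → Option C
  | .node n, k => G.prop (.inl n) k
  | .edge e, k => G.prop (.inr e) k
  | .const _, _ => none

/-- `lab(u)`; constants have no labels. -/
def PropertyGraph.valueLab (G : PropertyGraph N E L K C) : Value N E C → Set L
  | .node n => {l | l ∈ G.lab (.inl n)}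
  | .edge e => {l | l ∈ G.lab (.inr e)}
  | .const _ => ∅

/-- `prop(μ(x), k)`, which may be undefined. -/
def PropertyGraph.propAt (G : PropertyGraph N E L K C) (μ : Tuple V (Value N E C)) (x : V) (k : K) :
    Option C :=
  (μ x).bind fun u => G.valueProp u k

/-- Satisfaction of a pattern condition by a mapping. -/
def PatCond.Holds [LinearOrder C] (G : PropertyGraph N E L K C) (μ : Tuple V (Value N E C)) :
    PatCond V L K → Prop
  | .eq x k x' k' => ∃ c c', G.propAt μ x k = some c ∧ G.propAt μ x' k' = some c' ∧ c = c'
  | .lt x k x' k' => ∃ c c', G.propAt μ x k = some c ∧ G.propAt μ x' k' = some c' ∧ c < c'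
  | .label l x => ∃ u, μ x = some u ∧ l ∈ G.valueLab u
  | .or θ θ' => θ.Holds G μ ∨ θ'.Holds G μ
  | .and θ θ' => θ.Holds G μ ∧ θ'.Holds G μ
  | .not θ => ¬ θ.Holds G μ

/-- The concatenations of `i` successively concatenating paths from `P`; for `i = 0` these are the
single-node paths of `G`. -/
def PropertyGraph.iterate (G : PropertyGraph N E L K C) (P : Set (GPath N E)) :
    ℕ → Set (GPath N E)
  | 0 => {p | ∃ n ∈ G.nodes, p = GPath.single n}
  | i + 1 => {p | ∃ q ∈ G.iterate P i, ∃ r ∈ P, q.Concatenates r ∧ p = q.append r}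

/-- The semantics of a path pattern: a set of pairs of a path and a mapping of the free variables. -/
def Pattern.eval [LinearOrder C] (G : PropertyGraph N E L K C) :
    Pattern V L K → Set (GPath N E × Tuple V (Value N E C))
  | .node x => {r | ∃ n ∈ G.nodes, r = (GPath.single n, Tuple.bind x (.node n))}
  | .fwd x => {r | ∃ e ∈ G.edges, r = (⟨G.src e, [(e, G.tgt e)]⟩, Tuple.bind x (.edge e))}
  | .bwd x => {r | ∃ e ∈ G.edges, r = (⟨G.tgt e, [(e, G.src e)]⟩, Tuple.bind x (.edge e))}
  | .concat ψ ψ' => {r | ∃ a ∈ ψ.eval G, ∃ b ∈ ψ'.eval G, a.2.Compatible b.2 ∧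
      a.1.Concatenates b.1 ∧ r = (a.1.append b.1, a.2.join b.2)}
  | .rep ψ n m => {r | r.2 = Tuple.nil ∧ ∃ i : ℕ, n ≤ i ∧ (i : ℕ∞) ≤ m ∧
      r.1 ∈ G.iterate {p | ∃ μ, (p, μ) ∈ ψ.eval G} i}
  | .cond ψ θ => {r ∈ ψ.eval G | θ.Holds G r.2}
  | .union ψ ψ' => ψ.eval G ∪ ψ'.eval G

/-- The value of an output item under a mapping, which may be undefined. -/
def OutItem.value (G : PropertyGraph N E L K C) (μ : Tuple V (Value N E C)) :
    OutItem V K → Option (Value N E C)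
  | .var x => μ x
  | .prop x k => (G.propAt μ x k).map Value.const

/-- The projection of a mapping on an output specification. -/
def outTuple (G : PropertyGraph N E L K C) (μ : Tuple V (Value N E C)) (Ω : List (OutItem V K)) :
    Tuple (Attr V K) (Value N E C)
  | .out o => if o ∈ Ω then o.value G μ else none
  | .name _ => none

end Semantics

/-- A pattern with output: the relation symbols of the schema of patterns. -/
structure PatternOut (V L K : Type*) where
  pattern : Pattern V L K
  out : List (OutItem V K)
  wf : pattern.WellFormed
  out_fv : ∀ o ∈ out, o.base ∈ pattern.fv

namespace PatternOut

variable {V N E L K C : Type*}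

/-- The attributes of the relation symbol given by a pattern with output. -/
def sch (R : PatternOut V L K) : Set (Attr V K) := {a | ∃ o ∈ R.out, a = .out o}

/-- The semantics of a pattern with output. There are no nulls: a mapping contributes a tuple only
if every returned property is defined. -/
def eval [LinearOrder C] (G : PropertyGraph N E L K C) (R : PatternOut V L K) :
    Set (Tuple (Attr V K) (Value N E C)) :=
  {τ | ∃ p μ, (p, μ) ∈ R.pattern.eval G ∧ (∀ o ∈ R.out, o.value G μ ≠ none) ∧
    τ = outTuple G μ R.out}

end PatternOut

/-! ## Core PGQ and Core GQL -/

/-- Core PGQ queries: relational algebra over patterns with output. -/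
abbrev CorePGQ (V L K : Type*) :=
  {Q : RA (PatternOut V L K) (Attr V K) // Q.WellFormed PatternOut.sch}

/-- Core GQL queries: linear composition relational algebra over patterns with output. -/
abbrev CoreGQL (V L K : Type*) := LCRA.Query (PatternOut V L K) (Attr V K)

/-- The result of a Core PGQ query on a property graph. -/
def CorePGQ.result {V N E L K C : Type*} [LinearOrder C] (Q : CorePGQ V L K)
    (G : PropertyGraph N E L K C) : Set (Tuple (Attr V K) (Value N E C)) :=
  Q.1.eval (PatternOut.eval G)

/-- The result of a Core GQL query on a property graph. -/
def CoreGQL.result {V N E L K C : Type*} [LinearOrder C] (Q : CoreGQL V L K)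
    (G : PropertyGraph N E L K C) : Set (Tuple (Attr V K) (Value N E C)) :=
  LCRA.Query.output Q (PatternOut.eval G)

/-! ## Relational databases in the positional perspective -/

/-- A database with domain `U` over relation symbols `S` with arities `ar`. -/
abbrev Database {S : Type*} (ar : S → ℕ) (U : Type*) := ∀ s : S, Set (Fin (ar s) → U)

/-- The relation symbols of the relational representation of property graphs: all nodes, the pairs
of nodes joined by an edge, the nodes with a given label, the pairs of nodes joined by an edge with
a given label. -/
inductive GraphRel (L : Type*)
  | node
  | edge
  | nodeLabel (l : L)
  | edgeLabel (l : L)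

/-- The arities of these symbols. -/
def GraphRel.arity {L : Type*} : GraphRel L → ℕ
  | node => 1
  | edge => 2
  | nodeLabel _ => 1
  | edgeLabel _ => 2

/-- The relational representation of a property graph. -/
def PropertyGraph.database {N E L K C : Type*} (G : PropertyGraph N E L K C) :
    Database (GraphRel.arity (L := L)) N
  | .node => {t : Fin 1 → N | t 0 ∈ G.nodes}
  | .edge => {t : Fin 2 → N | ∃ e ∈ G.edges, t 0 = G.src e ∧ t 1 = G.tgt e}
  | .nodeLabel l => {t : Fin 1 → N | t 0 ∈ G.nodes ∧ l ∈ G.lab (.inl (t 0))}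
  | .edgeLabel l => {t : Fin 2 → N | ∃ e ∈ G.edges, l ∈ G.lab (.inr e) ∧
      t 0 = G.src e ∧ t 1 = G.tgt e}

/-! ## Linear Datalog -/

/-- An atom `S(x₁, …, xₖ)` with pairwise distinct variables. -/
structure Atom (V : Type*) {S : Type*} (ar : S → ℕ) where
  rel : S
  args : Fin (ar rel) → V
  distinct : Function.Injective args

/-- A valuation satisfies an atom. -/
def Atom.Holds {V U S : Type*} {ar : S → ℕ} (D : Database ar U) (μ : V → U) (a : Atom V ar) : Prop :=
  (fun i => μ (a.args i)) ∈ D a.rel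

/-- A rule with EDB symbols `S` and IDB symbols `I`: the head is an IDB atom, the body consists of
EDB and IDB atoms, and each variable of the head occurs in the body. -/
structure DatalogRule (V : Type*) {S I : Type*} (ar : S → ℕ) (arI : I → ℕ) where
  head : Atom V arI
  body : List (Atom V (Sum.elim ar arI))
  safe : ∀ i, ∃ b ∈ body, ∃ j, b.args j = head.args i

/-- A database over the EDB and one over the IDB symbols, taken together. -/
def Database.sum {U S I : Type*} {ar : S → ℕ} {arI : I → ℕ} (D : Database ar U)
    (J : Database arI U) : Database (Sum.elim ar arI) U
  | .inl s => D s
  | .inr i => J i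

/-- A Datalog program with EDB symbols `S`, finitely many IDB symbols `Fin numIDB`, a finite set of
rules, and an output symbol. -/
structure DatalogProgram (V : Type*) {S : Type*} (ar : S → ℕ) where
  numIDB : ℕ
  arIDB : Fin numIDB → ℕ
  rules : List (DatalogRule V ar arIDB)
  out : Fin numIDB

namespace DatalogProgram

variable {V U S : Type*} {ar : S → ℕ}

/-- An IDB instance satisfies all rules of the program over the EDB instance `D`. -/
def Satisfies (P : DatalogProgram V ar) (D : Database ar U) (J : Database P.arIDB U) : Prop :=
  ∀ ρ ∈ P.rules, ∀ μ : V → U, (∀ b ∈ ρ.body, b.Holds (D.sum J) μ) → ρ.head.Holds J μ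

/-- The semantics of a program: the least IDB instance that satisfies its rules. -/
def eval (P : DatalogProgram V ar) (D : Database ar U) : Database P.arIDB U :=
  fun i => {t | ∀ J : Database P.arIDB U, P.Satisfies D J → t ∈ J i}

/-- A program is linear if each rule has at most one occurrence of an IDB atom in its body. -/
def Linear (P : DatalogProgram V ar) : Prop :=
  ∀ ρ ∈ P.rules, ρ.body.countP (fun b => b.rel.isRight) ≤ 1

/-- A program is Boolean if its output symbol has arity `0`. -/
def Boolean (P : DatalogProgram V ar) : Prop := P.arIDB P.out = 0

/-- A Boolean program outputs true if it derives its output atom. -/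
def OutputsTrue (P : DatalogProgram V ar) (D : Database ar U) : Prop := (P.eval D P.out).Nonempty

end DatalogProgram

/-! ## Positive recursive SQL -/

/-- A block `SELECT cols FROM tables WHERE conds` over tables `T` with arities `ar`. The `FROM`
clause lists `numFrom` table references (a table may be listed repeatedly, under different aliases),
a column is referred to by the alias and its position, and the `WHERE` clause is a conjunction of
equalities of columns. -/
structure SelectBlock {T : Type*} (ar : T → ℕ) (k : ℕ) where
  numFrom : ℕ
  numFrom_pos : 0 < numFrom
  tables : Fin numFrom → T
  conds : List ((Σ i : Fin numFrom, Fin (ar (tables i))) × (Σ i : Fin numFrom, Fin (ar (tables i))))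
  cols : Fin k → (Σ i : Fin numFrom, Fin (ar (tables i)))

/-- The result of a select block, as a set of rows. -/
def SelectBlock.eval {T U : Type*} {ar : T → ℕ} {k : ℕ} (D : Database ar U) (b : SelectBlock ar k) :
    Set (Fin k → U) :=
  {t | ∃ row : ∀ i, Fin (ar (b.tables i)) → U, (∀ i, row i ∈ D (b.tables i)) ∧
    (∀ c ∈ b.conds, row c.1.1 c.1.2 = row c.2.1 c.2.2) ∧
    ∀ j, t j = row (b.cols j).1 (b.cols j).2}

/-- The `UNION` of select blocks. -/
def unionEval {T U : Type*} {ar : T → ℕ} {k : ℕ} (D : Database ar U) (bs : List (SelectBlock ar k)) :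
    Set (Fin k → U) :=
  {t | ∃ b ∈ bs, t ∈ b.eval D}

/-- Arities after adding one new table (named `none`) of arity `m`. -/
def extArity {T : Type*} (ar : T → ℕ) (m : ℕ) : Option T → ℕ
  | none => m
  | some s => ar s

/-- Adding one new table to a database. -/
def Database.ext {T U : Type*} {ar : T → ℕ} {m : ℕ} (D : Database ar U) (R : Set (Fin m → U)) :
    Database (extArity ar m) U
  | none => R
  | some s => D s

/-- Positive recursive SQL queries with `k` output columns: a main query preceded by recursive
common table expressions, `WITH RECURSIVE R₁ AS (…), R₂ AS (…), … main`. Each of them is a `UNION`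
of select blocks that may use the base tables, the tables defined before and the table being
defined, the last at most once in each `FROM` clause. -/
inductive RecSQL (k : ℕ) : {T : Type u} → (T → ℕ) → Type (u + 1)
  | main {T : Type u} {ar : T → ℕ} (blocks : List (SelectBlock ar k)) : RecSQL k ar
  | withRec {T : Type u} {ar : T → ℕ} (m : ℕ) (m_pos : 0 < m)
      (blocks : List (SelectBlock (extArity ar m) m))
      (linear : ∀ b ∈ blocks, ∀ i j, b.tables i = none → b.tables j = none → i = j)
      (rest : RecSQL k (extArity ar m)) : RecSQL k ar

/-- The least fixed point that defines a recursive common table expression. -/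
def recTable {T U : Type*} {ar : T → ℕ} {m : ℕ} (D : Database ar U)
    (blocks : List (SelectBlock (extArity ar m) m)) : Set (Fin m → U) :=
  ⋂₀ {R | unionEval (D.ext R) blocks ⊆ R}

/-- The result of a positive recursive SQL query. -/
def RecSQL.eval {k : ℕ} {U : Type*} : {T : Type u} → {ar : T → ℕ} → RecSQL k ar → Database ar U →
    Set (Fin k → U)
  | _, _, .main blocks, D => unionEval D blocks
  | _, _, .withRec _ _ blocks _ rest, D => rest.eval (D.ext (recTable D blocks))

/-! ## Expressibility of Boolean queries on property graphs; dataless paths -/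

section Expressibility

variable {N E L K C : Type*}

/-- A Boolean query on property graphs is expressible in positive recursive SQL (an SQL query is
read as true if its result is nonempty). -/
def ExpressibleRecSQL (q : PropertyGraph N E L K C → Prop) : Prop :=
  ∃ k : ℕ, 0 < k ∧ ∃ Q : RecSQL k (GraphRel.arity (L := L)), ∀ G : PropertyGraph N E L K C,
    q G ↔ (Q.eval G.database).Nonempty

/-- A Boolean query on property graphs is expressible in linear Datalog. -/
def ExpressibleLinearDatalog (V : Type*) (q : PropertyGraph N E L K C → Prop) : Prop :=
  ∃ P : DatalogProgram V (GraphRel.arity (L := L)), P.Linear ∧ P.Boolean ∧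
    ∀ G : PropertyGraph N E L K C, q G ↔ P.OutputsTrue G.database

/-- A Boolean query on property graphs is expressible in Core GQL. -/
def ExpressibleCoreGQL [LinearOrder C] (V : Type*) (q : PropertyGraph N E L K C → Prop) : Prop :=
  ∃ Q : CoreGQL V L K, ∀ G : PropertyGraph N E L K C, q G ↔ (Q.result G).Nonempty

/-- A Boolean query on property graphs is expressible in Core PGQ. -/
def ExpressibleCorePGQ [LinearOrder C] (V : Type*) (q : PropertyGraph N E L K C → Prop) : Prop :=
  ∃ Q : CorePGQ V L K, ∀ G : PropertyGraph N E L K C, q G ↔ (Q.result G).Nonempty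

/-- `G` is a dataless path of length `n`: distinct nodes `v₀, …, vₙ`, distinct edges
`eᵢ : vᵢ → vᵢ₊₁`, the label `first` on `v₀` and `last` on `vₙ`, no other labels and no
properties. -/
def IsDatalessPath (first last : L) (n : ℕ) (G : PropertyGraph N E L K C) : Prop :=
  ∃ (v : Fin (n + 1) → N) (e : Fin n → E), Function.Injective v ∧ Function.Injective e ∧
    (∀ x, x ∈ G.nodes ↔ ∃ i, x = v i) ∧
    (∀ y, y ∈ G.edges ↔ ∃ i, y = e i) ∧
    (∀ i, G.src (e i) = v i.castSucc ∧ G.tgt (e i) = v i.succ) ∧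
    (∀ i l, l ∈ G.lab (.inl (v i)) ↔ (i = 0 ∧ l = first) ∨ (i = Fin.last n ∧ l = last)) ∧
    (∀ i, G.lab (.inr (e i)) = ∅) ∧
    (∀ i k, G.prop (.inl (v i)) k = none) ∧
    (∀ i k, G.prop (.inr (e i)) k = none)

/-- `A` is the set of lengths of those dataless paths (of positive length) on which the Boolean
query `q` is true; in particular `q` does not distinguish dataless paths of equal length. -/
def DefinesLengths (first last : L) (q : PropertyGraph N E L K C → Prop) (A : Set ℕ) : Prop :=
  ∀ n, 0 < n → ∀ G, IsDatalessPath first last n G → (q G ↔ n ∈ A)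

end Expressibility

/-- Ultimately periodic sets of natural numbers. -/
def UltimatelyPeriodic (A : Set ℕ) : Prop :=
  ∃ t p : ℕ, 0 < p ∧ ∀ n, t < n → (n ∈ A ↔ n + p ∈ A)

end

end GraphQL

namespace GraphQL

open scoped Classical

/-! ## Regular languages -/

section RegularLanguages

variable {Γ Δ : Type*}

theorem isRegular_of_states {σ : Type*} [Finite σ] (step : σ → Γ → σ) (Q : σ → List Γ → Prop)
    (hstep : ∀ s a w, Q s (a :: w) ↔ Q (step s a) w) (s : σ) :
    Language.IsRegular ({w | Q s w} : Language Γ) := by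
  have := Fintype.ofFinite σ
  refine Language.isRegular_iff.mpr ⟨σ, inferInstance, ⟨step, s, {s | Q s []}⟩, ?_⟩
  have key : ∀ (w : List Γ) (s : σ), Q s w ↔ Q (w.foldl step s) [] := by
    intro w
    induction w with
    | nil => intro s; rfl
    | cons a w ih => intro s; rw [hstep, ih]; rfl
  ext w
  exact (key w s).symm

theorem IsRegular.comap {L : Language Γ} (h : L.IsRegular) (f : Δ → Γ) :
    Language.IsRegular ({w | w.map f ∈ L} : Language Δ) := by
  obtain ⟨σ, _, M, rfl⟩ := h
  exact ⟨σ, inferInstance, M.comap f, M.accepts_comap f⟩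

theorem IsRegular.image {L : Language Γ} (h : L.IsRegular) (f : Γ → Δ) :
    Language.IsRegular ({w | ∃ w' ∈ L, w'.map f = w} : Language Δ) := by
  apply Language.IsRegular.of_finite_range_leftQuotient
  refine (h.finite_range_leftQuotient.powerset.image
    fun 𝒮 : Set (Language Γ) =>
      ({v | ∃ q ∈ 𝒮, ∃ v' ∈ q, v'.map f = v} : Language Δ)).subset ?_
  rintro _ ⟨u, rfl⟩
  refine ⟨L.leftQuotient '' {u' | u'.map f = u}, Set.image_subset_range _ _, ?_⟩
  ext v
  constructor
  · rintro ⟨_, ⟨u', hu', rfl⟩, v', hv', rfl⟩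
    exact ⟨u' ++ v', hv', by rw [List.map_append, hu']⟩
  · rintro ⟨w, hw, hwv⟩
    obtain ⟨u', v', rfl, hu', hv'⟩ := List.map_eq_append_iff.mp hwv
    exact ⟨_, ⟨u', hu', rfl⟩, v', hw, hv'⟩

/-- Some letter satisfies `p`. -/
theorem isRegular_some (p : Γ → Prop) :
    Language.IsRegular ({w : List Γ | ∃ (i : ℕ) (a : Γ), w[i]? = some a ∧ p a} : Language Γ) := by
  have := isRegular_of_states (σ := Bool) (fun s a => s || decide (p a))
    (fun s (w : List Γ) => s = true ∨ ∃ (i : ℕ) (a : Γ), w[i]? = some a ∧ p a) ?_ false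
  · simpa using this
  · intro s a w
    cases s
    · simp only [Bool.false_or, decide_eq_true_eq, reduceCtorEq, false_or]
      constructor
      · rintro ⟨_ | i, b, h, hb⟩
        · simp at h; subst h; exact .inl hb
        · exact .inr ⟨i, b, by simpa using h, hb⟩
      · rintro (h | ⟨i, b, h, hb⟩)
        · exact ⟨0, a, by simp, h⟩
        · exact ⟨i + 1, b, by simpa using h, hb⟩
    · simp

/-- Some letter satisfying `p` is followed by one satisfying `q`. -/
theorem isRegular_adjacent (p q : Γ → Prop) :
    Language.IsRegular ({w : List Γ | ∃ (i : ℕ) (a b : Γ), w[i]? = some a ∧ w[i + 1]? = some b ∧ p a ∧ q b} :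
      Language Γ) := by
  have := isRegular_of_states (σ := Bool × Bool)
    (fun s a => (s.1 || (s.2 && decide (q a)), decide (p a)))
    (fun s (w : List Γ) => s.1 = true ∨ (s.2 = true ∧ ∃ b : Γ, w[0]? = some b ∧ q b) ∨
      ∃ (i : ℕ) (a b : Γ), w[i]? = some a ∧ w[i + 1]? = some b ∧ p a ∧ q b) ?_ (false, false)
  · simpa using this
  · rintro ⟨s, s'⟩ a w
    have : (∃ i c b, (a :: w)[i]? = some c ∧ (a :: w)[i + 1]? = some b ∧ p c ∧ q b) ↔
        (p a ∧ ∃ b, w[0]? = some b ∧ q b) ∨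
        ∃ i c b, w[i]? = some c ∧ w[i + 1]? = some b ∧ p c ∧ q b := by
      constructor
      · rintro ⟨_ | i, c, b, h, h', hc, hb⟩
        · simp at h; subst h; exact .inl ⟨hc, b, by simpa using h', hb⟩
        · exact .inr ⟨i, c, b, by simpa using h, by simpa using h', hc, hb⟩
      · rintro (⟨h, b, h', hb⟩ | ⟨i, c, b, h, h', hc, hb⟩)
        · exact ⟨0, a, b, by simp, by simpa using h', h, hb⟩
        · exact ⟨i + 1, c, b, by simpa using h, by simpa using h', hc, hb⟩
    rw [this]
    simp [or_assoc]

/-- Exactly one letter satisfies `p`. -/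
theorem isRegular_exactly_one (p : Γ → Prop) :
    Language.IsRegular ({w : List Γ | ∃ i : ℕ, ∀ j : ℕ, (∃ a : Γ, w[j]? = some a ∧ p a) ↔ j = i} :
      Language Γ) := by
  have := isRegular_of_states (σ := Fin 3)
    (fun s a => if p a then (if s = 0 then 1 else 2) else s)
    (fun s (w : List Γ) => (s = 0 ∧ ∃ i : ℕ, ∀ j : ℕ, (∃ a : Γ, w[j]? = some a ∧ p a) ↔ j = i) ∨
      (s = 1 ∧ ∀ (j : ℕ) (a : Γ), w[j]? = some a → ¬ p a)) ?_ 0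
  · simpa using this
  · intro s a w
    have h0 : (∀ (j : ℕ) (b : Γ), (a :: w)[j]? = some b → ¬ p b) ↔
        ¬ p a ∧ ∀ (j : ℕ) (b : Γ), w[j]? = some b → ¬ p b := by
      constructor
      · intro h
        exact ⟨h 0 a (by simp), fun j b hb => h (j + 1) b (by simpa using hb)⟩
      · rintro ⟨h, h'⟩ (_ | j) b hb
        · simp at hb; exact hb ▸ h
        · exact h' j b (by simpa using hb)
    have h1 : (∃ i : ℕ, ∀ j : ℕ, (∃ b, (a :: w)[j]? = some b ∧ p b) ↔ j = i) ↔
        (p a ∧ ∀ (j : ℕ) (b : Γ), w[j]? = some b → ¬ p b) ∨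
        (¬ p a ∧ ∃ i : ℕ, ∀ j : ℕ, (∃ b, w[j]? = some b ∧ p b) ↔ j = i) := by
      constructor
      · rintro ⟨i, hi⟩
        by_cases ha : p a
        · have : 0 = i := (hi 0).mp ⟨a, by simp, ha⟩
          subst this
          refine .inl ⟨ha, fun j b hb hpb => ?_⟩
          have := (hi (j + 1)).mp ⟨b, by simpa using hb, hpb⟩
          omega
        · refine .inr ⟨ha, ?_⟩
          cases i with
          | zero =>
            obtain ⟨b, hb, hpb⟩ := (hi 0).mpr rfl
            simp at hb
            exact absurd (hb ▸ hpb) ha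
          | succ i =>
            refine ⟨i, fun j => ?_⟩
            have := hi (j + 1)
            simpa using this
      · rintro (⟨ha, h⟩ | ⟨ha, i, hi⟩)
        · refine ⟨0, fun j => ?_⟩
          cases j with
          | zero => simp [ha]
          | succ j => simpa using h j
        · refine ⟨i + 1, fun j => ?_⟩
          cases j with
          | zero => simp [ha]
          | succ j => simpa using hi j
    simp only [h0, h1]
    by_cases ha : p a <;> fin_cases s <;> simp [ha]

end RegularLanguages

/-! ## Regular predicates

A predicate of a number `m`, of subsets of `Fin m` and of elements of `Fin m` is regular if a finite
automaton reads it off the word of length `m` whose letters list the sets and elements that hold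
each position. -/

section RegularPredicates

variable {α α' β β' : Type*}

/-- The word that encodes a family of sets and a family of elements of `Fin m`. -/
def word (m : ℕ) (X : α → Set (Fin m)) (x : β → Fin m) : List ((α → Prop) × (β → Prop)) :=
  List.ofFn fun j => (fun a => j ∈ X a, fun b => x b = j)

/-- Regular predicates. -/
def Reg (P : ∀ m : ℕ, (α → Set (Fin m)) → (β → Fin m) → Prop) : Prop :=
  ∃ L : Language ((α → Prop) × (β → Prop)), L.IsRegular ∧ ∀ m X x, P m X x ↔ word m X x ∈ L

theorem word_getElem? {m : ℕ} {X : α → Set (Fin m)} {x : β → Fin m} {i : ℕ}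
    {a : (α → Prop) × (β → Prop)} :
    (word m X x)[i]? = some a ↔ ∃ j : Fin m, i = j ∧ a = (fun a => j ∈ X a, fun b => x b = j) := by
  unfold word
  rw [List.getElem?_ofFn]
  constructor
  · intro h
    split_ifs at h with hi
    · exact ⟨⟨i, hi⟩, rfl, by simpa using h.symm⟩
  · rintro ⟨j, rfl, rfl⟩
    simp

variable {P Q : ∀ m : ℕ, (α → Set (Fin m)) → (β → Fin m) → Prop}

theorem Reg.congr (h : Reg P) (hPQ : ∀ m X x, Q m X x ↔ P m X x) : Reg Q := by
  obtain ⟨L, hL, h⟩ := h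
  exact ⟨L, hL, fun m X x => (hPQ m X x).trans (h m X x)⟩

theorem Reg.not (h : Reg P) : Reg fun m X x => ¬ P m X x := by
  obtain ⟨L, hL, h⟩ := h
  exact ⟨Lᶜ, hL.compl, fun m X x => not_congr (h m X x)⟩

theorem Reg.and (h : Reg P) (h' : Reg Q) : Reg fun m X x => P m X x ∧ Q m X x := by
  obtain ⟨L, hL, h⟩ := h
  obtain ⟨L', hL', h'⟩ := h'
  exact ⟨L ⊓ L', hL.inf hL', fun m X x => and_congr (h m X x) (h' m X x)⟩

theorem Reg.or (h : Reg P) (h' : Reg Q) : Reg fun m X x => P m X x ∨ Q m X x :=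
  (h.not.and h'.not).not.congr fun _ _ _ => by tauto

theorem Reg.imp (h : Reg P) (h' : Reg Q) : Reg fun m X x => P m X x → Q m X x :=
  (h.not.or h').congr fun _ _ _ => by tauto

theorem Reg.iff (h : Reg P) (h' : Reg Q) : Reg fun m X x => (P m X x ↔ Q m X x) :=
  ((h.imp h').and (h'.imp h)).congr fun _ _ _ => by tauto

theorem Reg.const (p : Prop) :
    Reg fun (m : ℕ) (_ : α → Set (Fin m)) (_ : β → Fin m) => p :=
  ⟨{_w | p}, isRegular_of_states (σ := Unit) (fun _ _ => ()) (fun _ _ => p) (by simp) (),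
    fun _ _ _ => Iff.rfl⟩

theorem Reg.forall_mem_finset {ι : Type*} (F : Finset ι)
    {P : ι → ∀ m : ℕ, (α → Set (Fin m)) → (β → Fin m) → Prop} (h : ∀ i ∈ F, Reg (P i)) :
    Reg fun m X x => ∀ i ∈ F, P i m X x := by
  induction F using Finset.induction_on with
  | empty => exact (Reg.const True).congr fun _ _ _ => by simp
  | insert i F _ ih =>
    refine ((h i (by simp)).and (ih fun j hj => h j (by simp [hj]))).congr fun _ _ _ => ?_
    simp

theorem Reg.comap {P : ∀ m : ℕ, (α' → Set (Fin m)) → (β' → Fin m) → Prop} (h : Reg P)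
    (f : α' → α) (g : β' → β) :
    Reg fun m (X : α → Set (Fin m)) (x : β → Fin m) => P m (fun a => X (f a)) (fun b => x (g b)) := by
  obtain ⟨L, hL, h⟩ := h
  refine ⟨_, IsRegular.comap hL fun l => (fun a => l.1 (f a), fun b => l.2 (g b)),
    fun m X x => (h m _ _).trans ?_⟩
  show _ ↔ List.map _ _ ∈ L
  rw [word, word, List.map_ofFn]
  rfl

theorem Reg.exists_sets
    {P : ∀ m : ℕ, (α → Set (Fin m)) → (α' → Set (Fin m)) → (β → Fin m) → Prop}
    (h : Reg fun m (X : α ⊕ α' → Set (Fin m)) (x : β → Fin m) =>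
      P m (fun a => X (.inl a)) (fun a => X (.inr a)) x) :
    Reg fun m X x => ∃ Y, P m X Y x := by
  obtain ⟨L, hL, h⟩ := h
  refine ⟨_, IsRegular.image hL fun l => (fun a => l.1 (.inl a), l.2), fun m X x => ?_⟩
  constructor
  · rintro ⟨Y, hY⟩
    refine ⟨_, (h m (Sum.elim X Y) x).mp hY, ?_⟩
    rw [word, word, List.map_ofFn]
    rfl
  · rintro ⟨w, hw, hwX⟩
    have hlen : w.length = m := by simpa [word] using congrArg List.length hwX
    subst hlen
    refine ⟨fun a => {j | (w.get j).1 (.inr a)}, ?_⟩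
    refine (h w.length (Sum.elim X fun a => {j | (w.get j).1 (.inr a)}) x).mpr ?_
    refine (congrArg (· ∈ L) ?_).mpr hw
    conv_rhs => rw [← List.ofFn_get w]
    unfold word
    congr 1
    ext1 j
    have hj : ((w.map fun l => (fun a => l.1 (Sum.inl a), l.2)) : List _)[(j : ℕ)]? = some _ :=
      hwX ▸ word_getElem?.mpr ⟨j, rfl, rfl⟩
    simp only [List.getElem?_map, Fin.is_lt, List.getElem?_eq_getElem, Option.map_some,
      Option.some.injEq, Prod.mk.injEq] at hj
    refine Prod.ext (funext fun a => ?_) hj.2.symm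
    cases a with
    | inl a => exact (congrFun hj.1 a).symm
    | inr a => rfl

theorem Reg.exists_elem
    {P : ∀ m : ℕ, (α → Set (Fin m)) → (β → Fin m) → Fin m → Prop}
    (h : Reg fun m (X : α → Set (Fin m)) (x : Option β → Fin m) =>
      P m X (fun b => x (some b)) (x none)) :
    Reg fun m X x => ∃ y, P m X x y := by
  obtain ⟨L, hL, h⟩ := h
  refine ⟨_, IsRegular.image (hL.inf (isRegular_exactly_one fun l => l.2 none))
    fun l => (l.1, fun b => l.2 (some b)), fun m X x => ?_⟩
  constructor
  · rintro ⟨y, hy⟩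
    refine ⟨_, ⟨(h m X (fun o => o.elim y x)).mp hy, y, fun j => ?_⟩, ?_⟩
    · constructor
      · rintro ⟨a, ha, ha'⟩
        obtain ⟨j', rfl, rfl⟩ := word_getElem?.mp ha
        exact congrArg Fin.val ha'.symm
      · rintro rfl
        exact ⟨_, word_getElem?.mpr ⟨y, rfl, rfl⟩, rfl⟩
    · rw [word, word, List.map_ofFn]
      rfl
  · rintro ⟨w, ⟨hw, i, hi⟩, hwX⟩
    have hlen : w.length = m := by simpa [word] using congrArg List.length hwX
    subst hlen
    obtain ⟨a, ha, ha'⟩ := (hi i).mpr rfl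
    obtain ⟨hlt, rfl⟩ := List.getElem?_eq_some_iff.mp ha
    refine ⟨⟨i, hlt⟩, ?_⟩
    refine (h w.length X (fun o => o.elim ⟨i, hlt⟩ x)).mpr ?_
    refine (congrArg (· ∈ L) ?_).mpr hw
    conv_rhs => rw [← List.ofFn_get w]
    unfold word
    congr 1
    ext1 j
    have hj : ((w.map fun l => (l.1, fun b => l.2 (some b))) : List _)[(j : ℕ)]? = some _ :=
      hwX ▸ word_getElem?.mpr ⟨j, rfl, rfl⟩
    simp only [List.getElem?_map, Fin.is_lt, List.getElem?_eq_getElem, Option.map_some,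
      Option.some.injEq, Prod.mk.injEq] at hj
    refine Prod.ext hj.1.symm (funext fun b => ?_)
    cases b with
    | some b => exact (congrFun hj.2 b).symm
    | none =>
      have := hi j
      simp only [Fin.is_lt, List.getElem?_eq_getElem, Option.some.injEq, exists_eq_left'] at this
      apply propext
      change _ ↔ (w[(j : ℕ)]).2 none
      rw [this, eq_comm]
      exact Fin.ext_iff (a := ⟨i, hlt⟩) (b := j)

theorem Reg.forall_sets
    {P : ∀ m : ℕ, (α → Set (Fin m)) → (α' → Set (Fin m)) → (β → Fin m) → Prop}
    (h : Reg fun m (X : α ⊕ α' → Set (Fin m)) (x : β → Fin m) =>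
      P m (fun a => X (.inl a)) (fun a => X (.inr a)) x) :
    Reg fun m X x => ∀ Y, P m X Y x :=
  (Reg.exists_sets (P := fun m X Y x => ¬ P m X Y x) h.not).not.congr fun _ _ _ => by simp

theorem Reg.forall_elem
    {P : ∀ m : ℕ, (α → Set (Fin m)) → (β → Fin m) → Fin m → Prop}
    (h : Reg fun m (X : α → Set (Fin m)) (x : Option β → Fin m) =>
      P m X (fun b => x (some b)) (x none)) :
    Reg fun m X x => ∀ y, P m X x y :=
  (Reg.exists_elem (P := fun m X x y => ¬ P m X x y) h.not).not.congr fun _ _ _ => by simp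

theorem reg_mem (b : β) (a : α) :
    Reg fun m (X : α → Set (Fin m)) (x : β → Fin m) => x b ∈ X a := by
  refine ⟨_, isRegular_some fun l => l.2 b ∧ l.1 a, fun m X x => ⟨fun h => ?_, ?_⟩⟩
  · exact ⟨x b, _, word_getElem?.mpr ⟨x b, rfl, rfl⟩, rfl, h⟩
  · rintro ⟨i, l, hl, h, h'⟩
    obtain ⟨j, rfl, rfl⟩ := word_getElem?.mp hl
    exact (show x b = j from h) ▸ h'

theorem reg_eq (b b' : β) :
    Reg fun m (_ : α → Set (Fin m)) (x : β → Fin m) => x b = x b' := by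
  refine ⟨_, isRegular_some fun l => l.2 b ∧ l.2 b', fun m X x => ⟨fun h => ?_, ?_⟩⟩
  · exact ⟨x b, _, word_getElem?.mpr ⟨x b, rfl, rfl⟩, rfl, h.symm⟩
  · rintro ⟨i, l, hl, h, h'⟩
    obtain ⟨j, rfl, rfl⟩ := word_getElem?.mp hl
    exact (show x b = j from h).trans (show x b' = j from h').symm

theorem reg_succ (b b' : β) :
    Reg fun m (_ : α → Set (Fin m)) (x : β → Fin m) => (x b' : ℕ) = x b + 1 := by
  refine ⟨_, isRegular_adjacent (fun l => l.2 b) fun l => l.2 b', fun m X x => ⟨fun h => ?_, ?_⟩⟩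
  · exact ⟨x b, _, _, word_getElem?.mpr ⟨x b, rfl, rfl⟩, word_getElem?.mpr ⟨x b', h.symm, rfl⟩,
      rfl, rfl⟩
  · rintro ⟨i, l, l', hl, hl', h, h'⟩
    obtain ⟨j, rfl, rfl⟩ := word_getElem?.mp hl
    obtain ⟨j', hj, rfl⟩ := word_getElem?.mp hl'
    rw [show x b = j from h, show x b' = j' from h', hj]

theorem reg_sets_eq (a a' : α) :
    Reg fun m (X : α → Set (Fin m)) (_ : β → Fin m) => X a = X a' :=
  (Reg.forall_elem (P := fun _ X _ y => y ∈ X a ↔ y ∈ X a')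
    ((reg_mem none a).iff (reg_mem none a'))).congr fun _ _ _ => Set.ext_iff

theorem reg_set_eq_empty (a : α) :
    Reg fun m (X : α → Set (Fin m)) (_ : β → Fin m) => X a = ∅ :=
  (Reg.forall_elem (P := fun _ X _ y => y ∉ X a) (reg_mem none a).not).congr
    fun _ _ _ => Set.eq_empty_iff_forall_notMem

theorem reg_set_eq_singleton (a : α) (b : β) :
    Reg fun m (X : α → Set (Fin m)) (x : β → Fin m) => X a = {x b} :=
  (Reg.forall_elem (P := fun _ X x y => y ∈ X a ↔ y = x b)
    ((reg_mem none a).iff (reg_eq none (some b)))).congr fun _ _ _ => Set.ext_iff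

theorem reg_isFirst (b : β) :
    Reg fun m (_ : α → Set (Fin m)) (x : β → Fin m) => (x b : ℕ) = 0 :=
  (Reg.exists_elem (P := fun _ _ x y => (x b : ℕ) = y + 1)
    (reg_succ none (some b))).not.congr fun m X x => by
      constructor
      · rintro h ⟨y, hy⟩
        omega
      · intro h
        by_contra h'
        exact h ⟨⟨x b - 1, by omega⟩, by simp; omega⟩

theorem reg_isLast (b : β) :
    Reg fun m (_ : α → Set (Fin m)) (x : β → Fin m) => (x b : ℕ) + 1 = m :=
  (Reg.exists_elem (P := fun _ _ x y => (y : ℕ) = x b + 1)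
    (reg_succ (some b) none)).not.congr fun m X x => by
      constructor
      · rintro h ⟨y, hy⟩
        omega
      · intro h
        by_contra h'
        exact h ⟨⟨x b + 1, by omega⟩, rfl⟩

theorem reg_succ_succ (b b' : β) :
    Reg fun m (_ : α → Set (Fin m)) (x : β → Fin m) => (x b' : ℕ) = x b + 2 :=
  (Reg.exists_elem (P := fun _ _ x y => (y : ℕ) = x b + 1 ∧ (x b' : ℕ) = y + 1)
    ((reg_succ (some b) none).and (reg_succ none (some b')))).congr fun m X x => by
      constructor
      · intro h
        exact ⟨⟨x b + 1, by omega⟩, rfl, h⟩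
      · rintro ⟨y, hy, hy'⟩
        omega

/-- A binary relation on positions that depends on sets of positions is regular. -/
def RegRel (B : ∀ m : ℕ, (α → Set (Fin m)) → Fin m → Fin m → Prop) : Prop :=
  Reg fun m X (x : Bool → Fin m) => B m X (x false) (x true)

variable {B B' : ∀ m : ℕ, (α → Set (Fin m)) → Fin m → Fin m → Prop}

theorem RegRel.apply (h : RegRel B) (f : α → α') (b b' : β) :
    Reg fun m (X : α' → Set (Fin m)) (x : β → Fin m) => B m (fun a => X (f a)) (x b) (x b') :=
  Reg.comap h f fun i => bif i then b' else b

theorem RegRel.comp (h : RegRel B) (h' : RegRel B') :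
    RegRel fun m X s t => ∃ u, B m X s u ∧ B' m X u t :=
  Reg.exists_elem (P := fun m X x u => B m X (x false) u ∧ B' m X u (x true))
    ((h.apply id (some false) none).and (h'.apply id none (some true)))

theorem RegRel.reflTransGen (h : RegRel B) :
    RegRel fun m X => Relation.ReflTransGen (B m X) := by
  have key : Reg fun m (X : α → Set (Fin m)) (x : Bool → Fin m) => ∀ Z : Unit → Set (Fin m),
      x false ∈ Z () → (∀ u v, u ∈ Z () → B m X u v → v ∈ Z ()) → x true ∈ Z () := by
    refine Reg.forall_sets (P := fun m X Z x =>
      x false ∈ Z () → (∀ u v, u ∈ Z () → B m X u v → v ∈ Z ()) → x true ∈ Z ()) ?_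
    refine (reg_mem _ _).imp (Reg.imp ?_ (reg_mem _ _))
    refine Reg.forall_elem (P := fun m (X : α ⊕ Unit → Set (Fin m)) (x : Bool → Fin m) u =>
      ∀ v, u ∈ X (.inr ()) → B m (fun a => X (.inl a)) u v → v ∈ X (.inr ())) ?_
    refine Reg.forall_elem (P := fun m (X : α ⊕ Unit → Set (Fin m)) (x : Option Bool → Fin m) v =>
      x none ∈ X (.inr ()) → B m (fun a => X (.inl a)) (x none) v → v ∈ X (.inr ())) ?_
    exact (reg_mem _ _).imp ((h.apply Sum.inl (some none) none).imp (reg_mem _ _))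
  refine key.congr fun m X x => ⟨fun hst Z hs hZ => ?_, fun hZ => ?_⟩
  · generalize x true = t at hst ⊢
    induction hst with
    | refl => exact hs
    | tail _ huv ih => exact hZ _ _ ih huv
  · exact hZ (fun _ => {t | Relation.ReflTransGen (B m X) (x false) t}) .refl
      fun u v hu huv => hu.tail huv

theorem reg_even (b : β) :
    Reg fun m (_ : α → Set (Fin m)) (x : β → Fin m) => Even (x b : ℕ) := by
  have h := RegRel.reflTransGen (α := α)
    (B := fun m X s t => (t : ℕ) = s + 2) (reg_succ_succ false true)
  refine (Reg.exists_elem (P := fun m _ x y => (y : ℕ) = 0 ∧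
    Relation.ReflTransGen (fun s t : Fin m => (t : ℕ) = s + 2) y (x b))
    ((reg_isFirst none).and (h.apply id none (some b)))).congr fun m X x => ?_
  generalize x b = t
  constructor
  · rintro ⟨k, hk⟩
    refine ⟨⟨0, by omega⟩, rfl, ?_⟩
    have : ∀ k (hk : k + k < m), Relation.ReflTransGen (fun s t : Fin m => (t : ℕ) = s + 2)
        ⟨0, by omega⟩ ⟨k + k, hk⟩ := by
      intro k
      induction k with
      | zero => intro _; exact .refl
      | succ k ih =>
        intro hk
        exact (ih (by omega)).tail (by simp; omega)
    have := this k (by omega)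
    rwa [show (⟨k + k, by omega⟩ : Fin m) = t from Fin.ext hk.symm] at this
  · rintro ⟨y, hy, hyt⟩
    induction hyt with
    | refl => simp [hy]
    | tail _ huv ih => rw [huv]; exact ih.add (by decide)

/-- `B` composed with itself `i` times; for `i = 0` it is the identity on the even positions. -/
def iterRel {m : ℕ} (B : Fin m → Fin m → Prop) : ℕ → Fin m → Fin m → Prop
  | 0 => fun s t => s = t ∧ Even (s : ℕ)
  | i + 1 => fun s t => ∃ u, iterRel B i s u ∧ B u t

theorem RegRel.iterRel (h : RegRel B) (i : ℕ) : RegRel fun m X => iterRel (B m X) i := by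
  induction i with
  | zero => exact (reg_eq false true).and (reg_even false)
  | succ i ih => exact ih.comp h

theorem iterRel_add_iff {m : ℕ} {B : Fin m → Fin m → Prop} {k : ℕ} {s t : Fin m} :
    (∃ i, k ≤ i ∧ GraphQL.iterRel B i s t) ↔
      ∃ u, GraphQL.iterRel B k s u ∧ Relation.ReflTransGen B u t := by
  constructor
  · rintro ⟨i, hi, h⟩
    obtain ⟨d, rfl⟩ := Nat.exists_eq_add_of_le hi
    clear hi
    induction d generalizing t with
    | zero => exact ⟨t, h, .refl⟩
    | succ d ih =>
      obtain ⟨u, hu, hut⟩ := h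
      obtain ⟨w, hw, hwu⟩ := ih hu
      exact ⟨w, hw, hwu.tail hut⟩
  · rintro ⟨u, hu, hut⟩
    induction hut with
    | refl => exact ⟨k, le_rfl, hu⟩
    | tail _ huv ih =>
      obtain ⟨i, hi, h⟩ := ih
      exact ⟨i + 1, by omega, _, h, huv⟩

theorem RegRel.iterRel_range (h : RegRel B) (k : ℕ) (l : ℕ∞) :
    RegRel fun m X s t => ∃ i : ℕ, k ≤ i ∧ (i : ℕ∞) ≤ l ∧ GraphQL.iterRel (B m X) i s t := by
  cases l with
  | top =>
    refine Reg.congr ((h.iterRel k).comp h.reflTransGen) fun m X x => ?_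
    simp [← iterRel_add_iff]
  | coe l =>
    refine (Reg.forall_mem_finset (Finset.Icc k l)
      fun i _ => Reg.not (h.iterRel i)).not.congr fun m X x => ?_
    simp

/-- The numbers at which a regular predicate without parameters holds. -/
theorem Reg.periodic {P : ℕ → Prop}
    (h : Reg fun (m : ℕ) (_ : α → Set (Fin m)) (_ : Empty → Fin m) => P m) :
    ∃ t p : ℕ, 0 < p ∧ ∀ n, t ≤ n → (P (2 * n + 1) ↔ P (2 * (n + p) + 1)) := by
  obtain ⟨L, hL, h⟩ := h
  set l : (α → Prop) × (Empty → Prop) := (fun _ => False, fun b => b.elim) with hl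
  have hP : ∀ m, P m ↔ List.replicate m l ∈ L := by
    intro m
    refine (h m (fun _ => ∅) (fun b => b.elim)).trans ?_
    rw [word, ← List.ofFn_const]
    refine iff_of_eq (congrArg (· ∈ L) (congrArg List.ofFn (funext fun j => ?_)))
    refine Prod.ext (funext fun a => ?_) (funext fun b => b.elim)
    simp [hl]
  have hfin := hL.finite_range_leftQuotient
  obtain ⟨i, j, hij, heq⟩ : ∃ i j, i < j ∧ L.leftQuotient (List.replicate (2 * i) l) =
      L.leftQuotient (List.replicate (2 * j) l) := by
    have := hfin.to_subtype
    obtain ⟨i, j, hne, heq⟩ := Finite.exists_ne_map_eq_of_infinite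
      fun i : ℕ => (⟨L.leftQuotient (List.replicate (2 * i) l), _, rfl⟩ :
        Set.range L.leftQuotient)
    have heq := congrArg Subtype.val heq
    rcases Nat.lt_or_gt_of_ne hne with h | h
    · exact ⟨i, j, h, heq⟩
    · exact ⟨j, i, h, heq.symm⟩
  refine ⟨i, j - i, by omega, fun n hn => ?_⟩
  rw [hP, hP, show 2 * n + 1 = 2 * i + (2 * (n - i) + 1) by omega,
    show 2 * (n + (j - i)) + 1 = 2 * j + (2 * (n - i) + 1) by omega,
    List.replicate_add (2 * i), List.replicate_add (2 * j), ← Language.mem_leftQuotient,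
    ← Language.mem_leftQuotient, heq]

end RegularPredicates

end GraphQL

namespace GraphQL

open scoped Classical

noncomputable section

/-! ## Patterns on dataless paths

The elements of a dataless path of length `n` are numbered by `Fin (2 * n + 1)`: position `2 * i` is
the node `vᵢ`, position `2 * i + 1` is the edge `eᵢ`. -/

section Positions

variable {V L K : Type*}

/-- The truth of a condition at positions, for mappings with domain `S`. -/
def PatCond.AtPositions (first last : L) (S : Set V) (m : ℕ) (X : V → Set (Fin m)) :
    PatCond V L K → Prop
  | .eq _ _ _ _ => False
  | .lt _ _ _ _ => False
  | .label l x => x ∈ S ∧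
      ∃ j : Fin m, j ∈ X x ∧ (((j : ℕ) = 0 ∧ l = first) ∨ ((j : ℕ) + 1 = m ∧ l = last))
  | .or θ θ' => θ.AtPositions first last S m X ∨ θ'.AtPositions first last S m X
  | .and θ θ' => θ.AtPositions first last S m X ∧ θ'.AtPositions first last S m X
  | .not θ => ¬ θ.AtPositions first last S m X

/-- The matches of a pattern: start position, end position, and values of the free variables. -/
def Pattern.atPositions (first last : L) (m : ℕ) :
    Pattern V L K → (V → Set (Fin m)) → Fin m → Fin m → Prop
  | .node x, X, s, t => s = t ∧ Even (s : ℕ) ∧ ∀ y, x = some y → X y = {s}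
  | .fwd x, X, s, t => Even (s : ℕ) ∧ ∃ j : Fin m, (j : ℕ) = s + 1 ∧ (t : ℕ) = j + 1 ∧
      ∀ y, x = some y → X y = {j}
  | .bwd x, X, s, t => Even (t : ℕ) ∧ ∃ j : Fin m, (j : ℕ) = t + 1 ∧ (s : ℕ) = j + 1 ∧
      ∀ y, x = some y → X y = {j}
  | .concat ψ ψ', X, s, t => ∃ u, ψ.atPositions first last m X s u ∧
      ψ'.atPositions first last m X u t
  | .rep ψ n l, _, s, t => ∃ i : ℕ, n ≤ i ∧ (i : ℕ∞) ≤ l ∧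
      iterRel (fun s t => ∃ Y, ψ.atPositions first last m Y s t) i s t
  | .cond ψ θ, X, s, t => ψ.atPositions first last m X s t ∧ θ.AtPositions first last ψ.fv m X
  | .union ψ ψ', X, s, t => ψ.atPositions first last m X s t ∨ ψ'.atPositions first last m X s t

theorem PatCond.reg_atPositions {β : Type*} (first last : L) (S : Set V) (θ : PatCond V L K) :
    Reg fun m X (_ : β → Fin m) => θ.AtPositions first last S m X := by
  induction θ with
  | eq | lt => exact Reg.const False
  | label l x =>
    refine (Reg.const (x ∈ S)).and ?_
    refine Reg.exists_elem (P := fun m X _ j => j ∈ X x ∧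
      (((j : ℕ) = 0 ∧ l = first) ∨ ((j : ℕ) + 1 = m ∧ l = last))) ?_
    exact (reg_mem _ _).and
      (((reg_isFirst _).and (Reg.const _)).or ((reg_isLast _).and (Reg.const _)))
  | or _ _ ih ih' => exact ih.or ih'
  | and _ _ ih ih' => exact ih.and ih'
  | not _ ih => exact ih.not

theorem reg_var_eq_singleton {β : Type*} (x : Option V) (b : β) :
    Reg fun m (X : V → Set (Fin m)) (z : β → Fin m) => ∀ y, x = some y → X y = {z b} := by
  cases x with
  | none => exact (Reg.const True).congr fun _ _ _ => by simp
  | some y => exact (reg_set_eq_singleton y b).congr fun _ _ _ => by simp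

theorem Pattern.regRel_atPositions (first last : L) (ψ : Pattern V L K) :
    RegRel fun m => ψ.atPositions first last m := by
  induction ψ with
  | node x => exact (reg_eq _ _).and ((reg_even _).and (reg_var_eq_singleton x false))
  | fwd x =>
    refine (reg_even false).and (Reg.exists_elem (P := fun m X (z : Bool → Fin m) j =>
      (j : ℕ) = z false + 1 ∧ (z true : ℕ) = j + 1 ∧ ∀ y, x = some y → X y = {j}) ?_)
    exact (reg_succ (some false) none).and
      ((reg_succ none (some true)).and (reg_var_eq_singleton x none))
  | bwd x =>
    refine (reg_even true).and (Reg.exists_elem (P := fun m X (z : Bool → Fin m) j =>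
      (j : ℕ) = z true + 1 ∧ (z false : ℕ) = j + 1 ∧ ∀ y, x = some y → X y = {j}) ?_)
    exact (reg_succ (some true) none).and
      ((reg_succ none (some false)).and (reg_var_eq_singleton x none))
  | concat ψ ψ' ih ih' => exact ih.comp ih'
  | rep ψ n l ih =>
    refine RegRel.iterRel_range (B := fun m _ s t => ∃ Y, ψ.atPositions first last m Y s t) ?_ n l
    refine Reg.exists_sets (P := fun m (_ : V → Set (Fin m)) Y z =>
      ψ.atPositions first last m Y (z false) (z true)) ?_
    exact ih.apply Sum.inr false true
  | cond ψ θ ih => exact ih.and (θ.reg_atPositions first last ψ.fv)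
  | union ψ ψ' ih ih' => exact ih.or ih'

/-- The free variables have single values. -/
theorem Pattern.atPositions_singleton {first last : L} {m : ℕ} {ψ : Pattern V L K}
    (hψ : ψ.WellFormed) {X : V → Set (Fin m)} {s t : Fin m}
    (h : ψ.atPositions first last m X s t) : ∀ x ∈ ψ.fv, ∃ j, X x = {j} := by
  induction ψ generalizing s t with
  | node x => exact fun y hy => ⟨s, h.2.2 y hy⟩
  | fwd x =>
    obtain ⟨_, j, _, _, h⟩ := h
    exact fun y hy => ⟨j, h y hy⟩
  | bwd x =>
    obtain ⟨_, j, _, _, h⟩ := h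
    exact fun y hy => ⟨j, h y hy⟩
  | concat ψ ψ' ih ih' =>
    obtain ⟨u, h, h'⟩ := h
    rintro x (hx | hx)
    · exact ih hψ.1 h x hx
    · exact ih' hψ.2 h' x hx
  | rep ψ n l ih => exact fun x hx => hx.elim
  | cond ψ θ ih => exact ih hψ h.1
  | union ψ ψ' ih ih' =>
    rcases h with h | h
    · exact ih hψ.1 h
    · exact fun x hx => ih' hψ.2.1 h x (hψ.2.2 ▸ hx)

end Positions

section Paths

variable {V N E L K C : Type*} {n : ℕ}

/-- The element of a path at a position. -/
def elementAt (v : Fin (n + 1) → N) (e : Fin n → E) (j : Fin (2 * n + 1)) : Value N E C :=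
  if h : Even (j : ℕ) then .node (v ⟨j / 2, by omega⟩)
  else .edge (e ⟨j / 2, by have := j.2; rw [Nat.even_iff] at h; omega⟩)

variable {v : Fin (n + 1) → N} {e : Fin n → E}

theorem elementAt_eq_node {j : Fin (2 * n + 1)} {i : Fin (n + 1)} (h : (j : ℕ) = 2 * i) :
    elementAt v e j = (.node (v i) : Value N E C) := by
  rw [elementAt, dif_pos (by simp [h])]
  congr 2
  exact Fin.ext (by simp [h])

theorem elementAt_eq_edge {j : Fin (2 * n + 1)} {i : Fin n} (h : (j : ℕ) = 2 * i + 1) :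
    elementAt v e j = (.edge (e i) : Value N E C) := by
  rw [elementAt, dif_neg (by simp [h])]
  congr 2
  exact Fin.ext (by simp [h]; omega)

theorem position_cases (j : Fin (2 * n + 1)) :
    (∃ i : Fin (n + 1), (j : ℕ) = 2 * i) ∨ ∃ i : Fin n, (j : ℕ) = 2 * i + 1 := by
  rcases Nat.even_or_odd' (j : ℕ) with ⟨i, hi | hi⟩
  · exact .inl ⟨⟨i, by omega⟩, hi⟩
  · exact .inr ⟨⟨i, by omega⟩, hi⟩

theorem elementAt_injective (hv : Function.Injective v) (he : Function.Injective e) :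
    Function.Injective (elementAt v e : _ → Value N E C) := by
  intro j j' h
  rcases position_cases j with ⟨i, hi⟩ | ⟨i, hi⟩ <;>
    rcases position_cases j' with ⟨i', hi'⟩ | ⟨i', hi'⟩
  · rw [elementAt_eq_node hi, elementAt_eq_node hi', Value.node.injEq] at h
    have := hv h
    exact Fin.ext (by rw [hi, hi', this])
  · rw [elementAt_eq_node hi, elementAt_eq_edge hi'] at h
    cases h
  · rw [elementAt_eq_edge hi, elementAt_eq_node hi'] at h
    cases h
  · rw [elementAt_eq_edge hi, elementAt_eq_edge hi', Value.edge.injEq] at h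
    have := he h
    exact Fin.ext (by rw [hi, hi', this])

theorem elementAt_eq_node_iff {j : Fin (2 * n + 1)} {u : N} :
    elementAt v e j = (.node u : Value N E C) ↔ ∃ i : Fin (n + 1), (j : ℕ) = 2 * i ∧ v i = u := by
  constructor
  · intro h
    rcases position_cases j with ⟨i, hi⟩ | ⟨i, hi⟩
    · rw [elementAt_eq_node hi, Value.node.injEq] at h
      exact ⟨i, hi, h⟩
    · rw [elementAt_eq_edge hi] at h
      cases h
  · rintro ⟨i, hi, rfl⟩
    exact elementAt_eq_node hi

/-- `v` and `e` list the nodes and edges of the dataless path `G`. -/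
structure IsListing (first last : L) (G : PropertyGraph N E L K C) (v : Fin (n + 1) → N)
    (e : Fin n → E) : Prop where
  node_inj : Function.Injective v
  edge_inj : Function.Injective e
  nodes : ∀ x, x ∈ G.nodes ↔ ∃ i, x = v i
  edges : ∀ y, y ∈ G.edges ↔ ∃ i, y = e i
  src_tgt : ∀ i, G.src (e i) = v i.castSucc ∧ G.tgt (e i) = v i.succ
  lab_node : ∀ i l, l ∈ G.lab (.inl (v i)) ↔ (i = 0 ∧ l = first) ∨ (i = Fin.last n ∧ l = last)
  lab_edge : ∀ i, G.lab (.inr (e i)) = ∅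
  prop_node : ∀ i k, G.prop (.inl (v i)) k = none
  prop_edge : ∀ i k, G.prop (.inr (e i)) k = none

theorem IsDatalessPath.exists_listing {first last : L} {G : PropertyGraph N E L K C}
    (h : IsDatalessPath first last n G) :
    ∃ (v : Fin (n + 1) → N) (e : Fin n → E), IsListing first last G v e := by
  obtain ⟨v, e, h1, h2, h3, h4, h5, h6, h7, h8, h9⟩ := h
  exact ⟨v, e, h1, h2, h3, h4, h5, h6, h7, h8, h9⟩

variable {first last : L} {G : PropertyGraph N E L K C}

theorem IsListing.valueProp (h : IsListing first last G v e) (j : Fin (2 * n + 1)) (k : K) :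
    G.valueProp (elementAt v e j) k = none := by
  rcases position_cases j with ⟨i, hi⟩ | ⟨i, hi⟩
  · rw [elementAt_eq_node hi]
    exact h.prop_node i k
  · rw [elementAt_eq_edge hi]
    exact h.prop_edge i k

theorem IsListing.mem_valueLab (h : IsListing first last G v e) (j : Fin (2 * n + 1)) (l : L) :
    l ∈ G.valueLab (elementAt v e j) ↔
      ((j : ℕ) = 0 ∧ l = first) ∨ ((j : ℕ) + 1 = 2 * n + 1 ∧ l = last) := by
  rcases position_cases j with ⟨i, hi⟩ | ⟨i, hi⟩
  · rw [elementAt_eq_node hi]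
    refine (h.lab_node i l).trans ?_
    rw [Fin.ext_iff, Fin.ext_iff, hi]
    simp
  · rw [elementAt_eq_edge hi]
    have : l ∉ G.lab (.inr (e i)) := by simp [h.lab_edge]
    refine iff_of_false this ?_
    omega

/-- The mapping `μ` has the values listed by `X` on `S`. -/
def Matches (v : Fin (n + 1) → N) (e : Fin n → E) (S : Set V) (X : V → Set (Fin (2 * n + 1)))
    (μ : Tuple V (Value N E C)) : Prop :=
  ∀ x ∈ S, X x = {j | μ x = some (elementAt v e j)}

/-- A mapping is total on `S`, undefined off `S`, and its values are elements of the path. -/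
def OnPath (v : Fin (n + 1) → N) (e : Fin n → E) (S : Set V) (μ : Tuple V (Value N E C)) : Prop :=
  ∀ x, (x ∈ S ∧ ∃ j, μ x = some (elementAt v e j)) ∨ (x ∉ S ∧ μ x = none)

theorem OnPath.mem_dom {S : Set V} {μ : Tuple V (Value N E C)} (h : OnPath v e S μ) {x : V} :
    x ∈ μ.dom ↔ x ∈ S := by
  rcases h x with ⟨h, j, hj⟩ | ⟨h, h'⟩
  · simp [Tuple.dom, hj, h]
  · simp [Tuple.dom, h', h]

theorem OnPath.propAt (hG : IsListing first last G v e) {S : Set V} {μ : Tuple V (Value N E C)}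
    (h : OnPath v e S μ) (x : V) (k : K) : G.propAt μ x k = none := by
  rcases h x with ⟨_, j, hj⟩ | ⟨_, h'⟩
  · simp [PropertyGraph.propAt, hj, hG.valueProp]
  · simp [PropertyGraph.propAt, h']

theorem PatCond.atPositions_iff [LinearOrder C] (hG : IsListing first last G v e) {S : Set V}
    {X : V → Set (Fin (2 * n + 1))} {μ : Tuple V (Value N E C)} (hμ : OnPath v e S μ)
    (hX : Matches v e S X μ) (θ : PatCond V L K) :
    θ.AtPositions first last S (2 * n + 1) X ↔ θ.Holds G μ := by
  induction θ with
  | eq | lt => simp [AtPositions, Holds, hμ.propAt hG]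
  | label l x =>
    constructor
    · rintro ⟨hx, j, hj, h⟩
      rw [hX x hx] at hj
      exact ⟨_, hj, (hG.mem_valueLab j l).mpr h⟩
    · rintro ⟨u, hu, hl⟩
      rcases hμ x with ⟨hx, j, hj⟩ | ⟨_, h'⟩
      · refine ⟨hx, j, by rw [hX x hx]; exact hj, (hG.mem_valueLab j l).mp ?_⟩
        rw [hj, Option.some.injEq] at hu
        rwa [hu]
      · rw [h'] at hu
        cases hu
  | or _ _ ih ih' => exact or_congr ih ih'
  | and _ _ ih ih' => exact and_congr ih ih'
  | not _ ih => exact not_congr ih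

theorem onPath_bind (x : Option V) (j : Fin (2 * n + 1)) :
    OnPath v e {y | x = some y} (Tuple.bind x (elementAt v e j : Value N E C)) := by
  intro y
  by_cases h : x = some y
  · exact .inl ⟨h, j, by simp [Tuple.bind, h]⟩
  · exact .inr ⟨h, by simp [Tuple.bind, h]⟩

theorem matches_bind (hv : Function.Injective v) (he : Function.Injective e) (x : Option V)
    (j : Fin (2 * n + 1)) (X : V → Set (Fin (2 * n + 1))) :
    Matches v e {y | x = some y} X (Tuple.bind x (elementAt v e j : Value N E C)) ↔
      ∀ y, x = some y → X y = {j} := by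
  refine forall_congr' fun y => imp_congr_right fun (hy : x = some y) => ?_
  have : {i | Tuple.bind x (elementAt v e j : Value N E C) y = some (elementAt v e i)} = {j} := by
    ext i
    simp [Tuple.bind, hy, (elementAt_injective hv he).eq_iff, eq_comm]
  rw [this]

theorem OnPath.join {S S' : Set V} {μ ν : Tuple V (Value N E C)} (hμ : OnPath v e S μ)
    (hν : OnPath v e S' ν) : OnPath v e (S ∪ S') (μ.join ν) := by
  intro x
  unfold Tuple.join
  by_cases hx : x ∈ S
  · rw [if_pos (hμ.mem_dom.mpr hx)]
    rcases hμ x with ⟨_, h⟩ | ⟨h, _⟩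
    · exact .inl ⟨.inl hx, h⟩
    · exact absurd hx h
  · rw [if_neg (mt hμ.mem_dom.mp hx)]
    rcases hν x with ⟨h, h'⟩ | ⟨h, h'⟩
    · exact .inl ⟨.inr h, h'⟩
    · exact .inr ⟨by simp [hx, h], h'⟩

theorem matches_join {S S' : Set V} {μ ν : Tuple V (Value N E C)} (hμ : OnPath v e S μ)
    (hν : OnPath v e S' ν) (hμν : μ.Compatible ν) (X : V → Set (Fin (2 * n + 1))) :
    Matches v e (S ∪ S') X (μ.join ν) ↔ Matches v e S X μ ∧ Matches v e S' X ν := by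
  have h1 : ∀ x ∈ S, μ.join ν x = μ x := fun x hx => if_pos (hμ.mem_dom.mpr hx)
  have h2 : ∀ x ∈ S', μ.join ν x = ν x := by
    intro x hx
    by_cases hx' : x ∈ μ.dom
    · rw [Tuple.join, if_pos hx']
      exact hμν x ⟨hx', hν.mem_dom.mpr hx⟩
    · exact if_neg hx'
  constructor
  · intro h
    exact ⟨fun x hx => by rw [h x (.inl hx), h1 x hx], fun x hx => by rw [h x (.inr hx), h2 x hx]⟩
  · rintro ⟨h, h'⟩ x (hx | hx)
    · rw [h x hx, h1 x hx]
    · rw [h' x hx, h2 x hx]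

theorem Matches.compatible {S S' : Set V} {μ ν : Tuple V (Value N E C)} (hμ : OnPath v e S μ)
    (hν : OnPath v e S' ν) {X : V → Set (Fin (2 * n + 1))} (h : Matches v e S X μ)
    (h' : Matches v e S' X ν) : μ.Compatible ν := by
  rintro x ⟨hx, hx'⟩
  rw [hμ.mem_dom] at hx
  rw [hν.mem_dom] at hx'
  rcases hμ x with ⟨_, j, hj⟩ | ⟨h, _⟩
  · have : j ∈ X x := by rw [h x hx]; exact hj
    rw [h' x hx'] at this
    rw [hj]
    exact Eq.symm this
  · exact absurd hx h

theorem GPath.last_append {p q : GPath N E} (h : p.Concatenates q) : (p.append q).last = q.last := by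
  obtain ⟨s, l⟩ := p
  obtain ⟨s', l'⟩ := q
  simp only [GPath.Concatenates, GPath.last] at h
  subst h
  simp [GPath.append, GPath.last, List.getLastD_eq_getLast?, List.getLast?_append, Option.getD_or]

/-- The start and the end of a path are at positions `s` and `t`. -/
def Ends (v : Fin (n + 1) → N) (e : Fin n → E) (p : GPath N E) (s t : Fin (2 * n + 1)) : Prop :=
  elementAt v e s = (.node p.start : Value N E Empty) ∧
    elementAt v e t = (.node p.last : Value N E Empty)

theorem Ends.append {p q : GPath N E} {s t u : Fin (2 * n + 1)} (h : Ends v e p s u)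
    (h' : Ends v e q u t) : p.Concatenates q ∧ Ends v e (p.append q) s t := by
  have hc : p.Concatenates q := by
    have := h.2.symm.trans h'.1
    simpa [GPath.Concatenates] using this
  exact ⟨hc, h.1, by rw [GPath.last_append hc]; exact h'.2⟩

theorem Ends.of_append {p q : GPath N E} {s t : Fin (2 * n + 1)} (hpq : p.Concatenates q)
    (h : Ends v e (p.append q) s t) (hp : ∃ i, v i = p.last) :
    ∃ u, Ends v e p s u ∧ Ends v e q u t := by
  obtain ⟨i, hi⟩ := hp
  have hu : elementAt v e ⟨2 * i, by omega⟩ = (.node p.last : Value N E Empty) := by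
    rw [← hi]
    exact elementAt_eq_node rfl
  refine ⟨⟨2 * i, by omega⟩, ⟨h.1, hu⟩, ?_, ?_⟩
  · rw [hu, hpq]
  · rw [← GPath.last_append hpq]
    exact h.2

theorem IsListing.mem_iterate (hG : IsListing first last G v e) {P : Set (GPath N E)}
    (hP : ∀ p ∈ P, ∃ i, v i = p.last) (i : ℕ) :
    ∀ p ∈ G.iterate P i, ∃ i, v i = p.last := by
  induction i with
  | zero =>
    rintro p ⟨u, hu, rfl⟩
    obtain ⟨i, rfl⟩ := (hG.nodes u).mp hu
    exact ⟨i, rfl⟩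
  | succ i ih =>
    rintro p ⟨q, hq, r, hr, hqr, rfl⟩
    rw [GPath.last_append hqr]
    exact hP r hr

theorem IsListing.iterRel_iff (hG : IsListing first last G v e) {P : Set (GPath N E)}
    (hP : ∀ p ∈ P, ∃ i, v i = p.last) {B : Fin (2 * n + 1) → Fin (2 * n + 1) → Prop}
    (hB : ∀ s t, B s t ↔ ∃ p ∈ P, Ends v e p s t) (i : ℕ) (s t : Fin (2 * n + 1)) :
    iterRel B i s t ↔ ∃ p ∈ G.iterate P i, Ends v e p s t := by
  induction i generalizing t with
  | zero =>
    constructor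
    · rintro ⟨rfl, hs⟩
      obtain ⟨i, hi⟩ | ⟨i, hi⟩ := position_cases s
      · exact ⟨.single (v i), ⟨_, (hG.nodes _).mpr ⟨i, rfl⟩, rfl⟩, elementAt_eq_node hi,
          elementAt_eq_node hi⟩
      · rw [Nat.even_iff] at hs
        omega
    · rintro ⟨_, ⟨u, hu, rfl⟩, hs, ht⟩
      refine ⟨elementAt_injective hG.node_inj hG.edge_inj (hs.trans ht.symm), ?_⟩
      obtain ⟨i, hi, _⟩ := elementAt_eq_node_iff.mp hs
      simp [hi]
  | succ i ih =>
    constructor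
    · rintro ⟨u, hsu, hut⟩
      obtain ⟨p, hp, hps⟩ := (ih u).mp hsu
      obtain ⟨q, hq, hqs⟩ := (hB u t).mp hut
      have := hps.append hqs
      exact ⟨_, ⟨p, hp, q, hq, this.1, rfl⟩, this.2⟩
    · rintro ⟨_, ⟨p, hp, q, hq, hpq, rfl⟩, h⟩
      obtain ⟨u, hu, hu'⟩ := h.of_append hpq (hG.mem_iterate hP i p hp)
      exact ⟨u, (ih u).mpr ⟨p, hp, hu⟩, (hB u t).mpr ⟨q, hq, hu'⟩⟩

theorem IsListing.edge_cases (hG : IsListing first last G v e) {y : E} (hy : y ∈ G.edges) :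
    ∃ i : Fin n, y = e i ∧ G.src y = v i.castSucc ∧ G.tgt y = v i.succ := by
  obtain ⟨i, rfl⟩ := (hG.edges y).mp hy
  exact ⟨i, rfl, hG.src_tgt i⟩

theorem Pattern.eval_onPath [LinearOrder C] (hG : IsListing first last G v e) {ψ : Pattern V L K}
    (hψ : ψ.WellFormed) :
    ∀ r ∈ ψ.eval G, OnPath v e ψ.fv r.2 ∧ ∃ i, v i = r.1.last := by
  induction ψ with
  | node x =>
    rintro _ ⟨u, hu, rfl⟩
    obtain ⟨i, rfl⟩ := (hG.nodes u).mp hu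
    have := onPath_bind (v := v) (e := e) (C := C) x ⟨2 * i, by omega⟩
    rw [elementAt_eq_node (i := i) rfl] at this
    exact ⟨this, i, rfl⟩
  | fwd x =>
    rintro _ ⟨y, hy, rfl⟩
    obtain ⟨i, rfl, hs, ht⟩ := hG.edge_cases hy
    have := onPath_bind (v := v) (e := e) (C := C) x ⟨2 * i + 1, by omega⟩
    rw [elementAt_eq_edge (i := i) rfl] at this
    exact ⟨this, i.succ, by simp [GPath.last, ht]⟩
  | bwd x =>
    rintro _ ⟨y, hy, rfl⟩
    obtain ⟨i, rfl, hs, ht⟩ := hG.edge_cases hy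
    have := onPath_bind (v := v) (e := e) (C := C) x ⟨2 * i + 1, by omega⟩
    rw [elementAt_eq_edge (i := i) rfl] at this
    exact ⟨this, i.castSucc, by simp [GPath.last, hs]⟩
  | concat ψ ψ' ih ih' =>
    rintro _ ⟨a, ha, b, hb, hab, hc, rfl⟩
    refine ⟨(ih hψ.1 a ha).1.join (ih' hψ.2 b hb).1, ?_⟩
    rw [GPath.last_append hc]
    exact (ih' hψ.2 b hb).2
  | rep ψ k l ih =>
    rintro ⟨p, μ⟩ ⟨hμ, i, _, _, hp⟩
    refine ⟨fun x => .inr ⟨fun h => h.elim, by simp only at hμ; rw [hμ]; rfl⟩, ?_⟩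
    refine hG.mem_iterate ?_ i p hp
    rintro q ⟨ν, hν⟩
    exact (ih hψ.1 _ hν).2
  | cond ψ θ ih => exact fun r hr => ih hψ r hr.1
  | union ψ ψ' ih ih' =>
    rintro r (hr | hr)
    · exact ih hψ.1 r hr
    · have := ih' hψ.2.1 r hr
      rw [← hψ.2.2] at this
      exact this

theorem IsListing.start_mem_iterate (hG : IsListing first last G v e) (P : Set (GPath N E)) (i : ℕ) :
    ∀ p ∈ G.iterate P i, ∃ i, v i = p.start := by
  induction i with
  | zero =>
    rintro p ⟨u, hu, rfl⟩
    obtain ⟨i, rfl⟩ := (hG.nodes u).mp hu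
    exact ⟨i, rfl⟩
  | succ i ih =>
    rintro p ⟨q, hq, r, hr, hqr, rfl⟩
    exact ih q hq

theorem Pattern.eval_start [LinearOrder C] (hG : IsListing first last G v e) (ψ : Pattern V L K) :
    ∀ r ∈ ψ.eval G, ∃ i, v i = r.1.start := by
  induction ψ with
  | node x =>
    rintro _ ⟨u, hu, rfl⟩
    obtain ⟨i, rfl⟩ := (hG.nodes u).mp hu
    exact ⟨i, rfl⟩
  | fwd x =>
    rintro _ ⟨y, hy, rfl⟩
    obtain ⟨i, -, hs, -⟩ := hG.edge_cases hy
    exact ⟨_, hs.symm⟩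
  | bwd x =>
    rintro _ ⟨y, hy, rfl⟩
    obtain ⟨i, -, -, ht⟩ := hG.edge_cases hy
    exact ⟨_, ht.symm⟩
  | concat ψ ψ' ih ih' =>
    rintro _ ⟨a, ha, b, hb, hab, hc, rfl⟩
    exact ih a ha
  | rep ψ k l ih =>
    rintro ⟨p, μ⟩ ⟨_, i, _, _, hp⟩
    exact hG.start_mem_iterate _ i p hp
  | cond ψ θ ih => exact fun r hr => ih r hr.1
  | union ψ ψ' ih ih' => exact fun r hr => hr.elim (ih r) (ih' r)

theorem Pattern.exists_ends [LinearOrder C] (hG : IsListing first last G v e) {ψ : Pattern V L K}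
    (hψ : ψ.WellFormed) {r : GPath N E × Tuple V (Value N E C)} (hr : r ∈ ψ.eval G) :
    ∃ s t, Ends v e r.1 s t := by
  obtain ⟨i, hi⟩ := ψ.eval_start hG r hr
  obtain ⟨j, hj⟩ := (eval_onPath hG hψ r hr).2
  exact ⟨⟨2 * i, by omega⟩, ⟨2 * j, by omega⟩, elementAt_eq_node_iff.mpr ⟨i, rfl, hi⟩,
    elementAt_eq_node_iff.mpr ⟨j, rfl, hj⟩⟩

theorem Pattern.atPositions_iff [LinearOrder C] (hG : IsListing first last G v e)
    {ψ : Pattern V L K} (hψ : ψ.WellFormed) (X : V → Set (Fin (2 * n + 1)))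
    (s t : Fin (2 * n + 1)) :
    ψ.atPositions first last (2 * n + 1) X s t ↔
      ∃ r ∈ ψ.eval G, Ends v e r.1 s t ∧ Matches v e ψ.fv X r.2 := by
  induction ψ generalizing X s t with
  | node x =>
    constructor
    · rintro ⟨rfl, hs, hX⟩
      obtain ⟨i, hi⟩ | ⟨i, hi⟩ := position_cases s
      · refine ⟨_, ⟨v i, (hG.nodes _).mpr ⟨i, rfl⟩, rfl⟩,
          ⟨elementAt_eq_node hi, elementAt_eq_node hi⟩, ?_⟩
        have := (matches_bind (C := C) hG.node_inj hG.edge_inj x s X).mpr hX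
        rwa [elementAt_eq_node hi] at this
      · rw [Nat.even_iff] at hs
        omega
    · rintro ⟨_, ⟨u, hu, rfl⟩, ⟨hs, ht⟩, hX⟩
      obtain ⟨i, hi, rfl⟩ := elementAt_eq_node_iff.mp hs
      refine ⟨elementAt_injective hG.node_inj hG.edge_inj (hs.trans ht.symm), by simp [hi], ?_⟩
      rw [← matches_bind (C := C) hG.node_inj hG.edge_inj, elementAt_eq_node hi]
      exact hX
  | fwd x =>
    constructor
    · rintro ⟨hs, j, hj, ht, hX⟩
      obtain ⟨i, hi⟩ | ⟨i, hi⟩ := position_cases j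
      · rw [Nat.even_iff] at hs
        omega
      · refine ⟨_, ⟨e i, (hG.edges _).mpr ⟨i, rfl⟩, rfl⟩, ⟨?_, ?_⟩, ?_⟩
        · rw [(hG.src_tgt i).1]
          exact elementAt_eq_node (by simp; omega)
        · simp only [GPath.last, (hG.src_tgt i).2]
          exact elementAt_eq_node (by simp; omega)
        · have := (matches_bind (C := C) hG.node_inj hG.edge_inj x j X).mpr hX
          rwa [elementAt_eq_edge hi] at this
    · rintro ⟨_, ⟨y, hy, rfl⟩, ⟨hs, ht⟩, hX⟩
      obtain ⟨i, rfl, h1, h2⟩ := hG.edge_cases hy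
      obtain ⟨a, ha, ha'⟩ := elementAt_eq_node_iff.mp hs
      obtain ⟨b, hb, hb'⟩ := elementAt_eq_node_iff.mp ht
      obtain rfl : a = i.castSucc := hG.node_inj (ha'.trans h1)
      obtain rfl : b = i.succ := hG.node_inj (hb'.trans (by simp [GPath.last, h2]))
      refine ⟨by simp [ha], ⟨2 * i + 1, by omega⟩, by simp [ha], by simp [hb]; omega, ?_⟩
      rw [← matches_bind (C := C) hG.node_inj hG.edge_inj, elementAt_eq_edge (i := i) rfl]
      exact hX
  | bwd x =>
    constructor
    · rintro ⟨hs, j, hj, ht, hX⟩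
      obtain ⟨i, hi⟩ | ⟨i, hi⟩ := position_cases j
      · rw [Nat.even_iff] at hs
        omega
      · refine ⟨_, ⟨e i, (hG.edges _).mpr ⟨i, rfl⟩, rfl⟩, ⟨?_, ?_⟩, ?_⟩
        · rw [(hG.src_tgt i).2]
          exact elementAt_eq_node (by simp; omega)
        · simp only [GPath.last, (hG.src_tgt i).1]
          exact elementAt_eq_node (by simp; omega)
        · have := (matches_bind (C := C) hG.node_inj hG.edge_inj x j X).mpr hX
          rwa [elementAt_eq_edge hi] at this
    · rintro ⟨_, ⟨y, hy, rfl⟩, ⟨hs, ht⟩, hX⟩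
      obtain ⟨i, rfl, h1, h2⟩ := hG.edge_cases hy
      obtain ⟨a, ha, ha'⟩ := elementAt_eq_node_iff.mp hs
      obtain ⟨b, hb, hb'⟩ := elementAt_eq_node_iff.mp ht
      obtain rfl : a = i.succ := hG.node_inj (ha'.trans h2)
      obtain rfl : b = i.castSucc := hG.node_inj (hb'.trans (by simp [GPath.last, h1]))
      refine ⟨by simp [hb], ⟨2 * i + 1, by omega⟩, by simp [hb], by simp [ha]; omega, ?_⟩
      rw [← matches_bind (C := C) hG.node_inj hG.edge_inj, elementAt_eq_edge (i := i) rfl]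
      exact hX
  | concat ψ ψ' ih ih' =>
    constructor
    · rintro ⟨u, h, h'⟩
      obtain ⟨a, ha, has, hX⟩ := (ih hψ.1 X s u).mp h
      obtain ⟨b, hb, hbs, hX'⟩ := (ih' hψ.2 X u t).mp h'
      have hae := (eval_onPath hG hψ.1 a ha).1
      have hbe := (eval_onPath hG hψ.2 b hb).1
      have hab := hX.compatible hae hbe hX'
      have := has.append hbs
      exact ⟨_, ⟨a, ha, b, hb, hab, this.1, rfl⟩, this.2,
        (matches_join hae hbe hab X).mpr ⟨hX, hX'⟩⟩
    · rintro ⟨_, ⟨a, ha, b, hb, hab, hc, rfl⟩, hst, hX⟩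
      have hae := eval_onPath hG hψ.1 a ha
      have hbe := eval_onPath hG hψ.2 b hb
      obtain ⟨u, hu, hu'⟩ := hst.of_append hc hae.2
      have := (matches_join hae.1 hbe.1 hab X).mp hX
      exact ⟨u, (ih hψ.1 X s u).mpr ⟨a, ha, hu, this.1⟩, (ih' hψ.2 X u t).mpr ⟨b, hb, hu', this.2⟩⟩
  | rep ψ k l ih =>
    have hP : ∀ p ∈ {p | ∃ μ, (p, μ) ∈ ψ.eval G}, ∃ i, v i = p.last := by
      rintro p ⟨μ, hμ⟩
      exact (eval_onPath hG hψ.1 _ hμ).2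
    have hB : ∀ s t, (∃ Y, ψ.atPositions first last (2 * n + 1) Y s t) ↔
        ∃ p ∈ {p | ∃ μ, (p, μ) ∈ ψ.eval G}, Ends v e p s t := by
      intro s t
      constructor
      · rintro ⟨Y, hY⟩
        obtain ⟨r, hr, hst, _⟩ := (ih hψ.1 Y s t).mp hY
        exact ⟨r.1, ⟨r.2, hr⟩, hst⟩
      · rintro ⟨p, ⟨μ, hμ⟩, hst⟩
        exact ⟨fun x => {j | μ x = some (elementAt v e j)},
          (ih hψ.1 _ s t).mpr ⟨_, hμ, hst, fun _ _ => rfl⟩⟩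
    have := hG.iterRel_iff hP hB
    constructor
    · rintro ⟨i, hi, hi', h⟩
      obtain ⟨p, hp, hst⟩ := (this i s t).mp h
      exact ⟨(p, Tuple.nil), ⟨rfl, i, hi, hi', hp⟩, hst, fun x hx => hx.elim⟩
    · rintro ⟨r, ⟨_, i, hi, hi', hp⟩, hst, _⟩
      exact ⟨i, hi, hi', (this i s t).mpr ⟨_, hp, hst⟩⟩
  | cond ψ θ ih =>
    constructor
    · rintro ⟨h, hθ⟩
      obtain ⟨r, hr, hst, hX⟩ := (ih hψ X s t).mp h
      exact ⟨r, ⟨hr, (θ.atPositions_iff hG (eval_onPath hG (ψ := ψ) hψ r hr).1 hX).mp hθ⟩, hst, hX⟩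
    · rintro ⟨r, ⟨hr, hθ⟩, hst, hX⟩
      exact ⟨(ih hψ X s t).mpr ⟨r, hr, hst, hX⟩,
        (θ.atPositions_iff hG (eval_onPath hG (ψ := ψ) hψ r hr).1 hX).mpr hθ⟩
  | union ψ ψ' ih ih' =>
    refine (or_congr (ih hψ.1 X s t) (ih' hψ.2.1 X s t)).trans ?_
    rw [← hψ.2.2]
    constructor
    · rintro (⟨r, hr, h⟩ | ⟨r, hr, h⟩)
      · exact ⟨r, .inl hr, h⟩
      · exact ⟨r, .inr hr, h⟩
    · rintro ⟨r, hr | hr, h⟩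
      · exact .inl ⟨r, hr, h⟩
      · exact .inr ⟨r, hr, h⟩

end Paths

end

end GraphQL

namespace GraphQL

open scoped Classical

noncomputable section

/-! ## Tables of tuples of positions -/

section Tables

variable {A : Type*}

/-- The sets that represent the values of a tuple at the attributes in `F`. -/
def Encodes {m : ℕ} (F : Finset A) (X : A → Set (Fin m)) (τ : Tuple A (Fin m)) : Prop :=
  ∀ a ∈ F, X a = {j | τ a = some j}

/-- A family of tables, one for each `m`, is regular if its attributes are in the finite set `F` and
if its tuples are recognized by a finite automaton. -/
def RegTable (F : Finset A) (T : ∀ m : ℕ, Set (Tuple A (Fin m))) : Prop :=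
  (∀ m, ∀ τ ∈ T m, ∀ a ∉ F, τ a = none) ∧
    Reg fun m X (_ : Empty → Fin m) => ∃ τ ∈ T m, Encodes F X τ

theorem setOf_eq_some_injective {m : ℕ} {o o' : Option (Fin m)}
    (h : {j | o = some j} = {j | o' = some j}) : o = o' :=
  Option.ext fun j => Set.ext_iff.mp h j

theorem setOf_eq_some_eq_empty {m : ℕ} {o : Option (Fin m)} :
    {j | o = some j} = ∅ ↔ o = none := by
  cases o with
  | none => simp
  | some i => simp

theorem Encodes.congr_tuple {m : ℕ} {F : Finset A} {X : A → Set (Fin m)} {τ τ' : Tuple A (Fin m)}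
    (h : Encodes F X τ) (h' : Encodes F X τ') (hτ : ∀ a ∉ F, τ a = none)
    (hτ' : ∀ a ∉ F, τ' a = none) : τ = τ' := by
  funext a
  by_cases ha : a ∈ F
  · exact setOf_eq_some_injective ((h a ha).symm.trans (h' a ha))
  · rw [hτ a ha, hτ' a ha]

theorem encodes_self {m : ℕ} (F : Finset A) (τ : Tuple A (Fin m)) :
    Encodes F (fun a => {j | τ a = some j}) τ :=
  fun _ _ => rfl

variable {F F' : Finset A} {T T' : ∀ m : ℕ, Set (Tuple A (Fin m))}

theorem RegTable.mono (h : RegTable F T) (hF : F ⊆ F') : RegTable F' T := by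
  refine ⟨fun m τ hτ a ha => h.1 m τ hτ a fun ha' => ha (hF ha'), ?_⟩
  refine (h.2.and (Reg.forall_mem_finset (F' \ F)
    fun a _ => reg_set_eq_empty a)).congr fun m X _ => ?_
  constructor
  · rintro ⟨τ, hτ, hX⟩
    refine ⟨⟨τ, hτ, fun a ha => hX a (hF ha)⟩, fun a ha => ?_⟩
    rw [Finset.mem_sdiff] at ha
    rw [hX a ha.1, h.1 m τ hτ a ha.2]
    simp
  · rintro ⟨⟨τ, hτ, hX⟩, hX'⟩
    refine ⟨τ, hτ, fun a ha => ?_⟩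
    by_cases ha' : a ∈ F
    · exact hX a ha'
    · rw [hX' a (by simp [ha, ha']), h.1 m τ hτ a ha']
      simp

theorem RegTable.union (h : RegTable F T) (h' : RegTable F T') :
    RegTable F fun m => T m ∪ T' m := by
  refine ⟨fun m τ hτ => hτ.elim (h.1 m τ) (h'.1 m τ), (h.2.or h'.2).congr fun m X _ => ?_⟩
  simp only [Set.mem_union, or_and_right, exists_or]

theorem RegTable.inter (h : RegTable F T) (h' : RegTable F T') :
    RegTable F fun m => T m ∩ T' m := by
  refine ⟨fun m τ hτ => h.1 m τ hτ.1, (h.2.and h'.2).congr fun m X _ => ?_⟩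
  constructor
  · rintro ⟨τ, hτ, hX⟩
    exact ⟨⟨τ, hτ.1, hX⟩, ⟨τ, hτ.2, hX⟩⟩
  · rintro ⟨⟨τ, hτ, hX⟩, ⟨τ', hτ', hX'⟩⟩
    obtain rfl := hX.congr_tuple hX' (h.1 m τ hτ) (h'.1 m τ' hτ')
    exact ⟨τ, ⟨hτ, hτ'⟩, hX⟩

theorem RegTable.diff (h : RegTable F T) (h' : RegTable F T') :
    RegTable F fun m => T m \ T' m := by
  refine ⟨fun m τ hτ => h.1 m τ hτ.1, (h.2.and h'.2.not).congr fun m X _ => ?_⟩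
  constructor
  · rintro ⟨τ, hτ, hX⟩
    refine ⟨⟨τ, hτ.1, hX⟩, fun ⟨τ', hτ', hX'⟩ => hτ.2 ?_⟩
    rwa [hX.congr_tuple hX' (h.1 m τ hτ.1) (h'.1 m τ' hτ')]
  · rintro ⟨⟨τ, hτ, hX⟩, hn⟩
    exact ⟨τ, ⟨hτ, fun hτ' => hn ⟨τ, hτ', hX⟩⟩, hX⟩

theorem SelCond.exists_reg (F : Finset A) (θ : SelCond A) :
    ∃ P : ∀ m : ℕ, (A → Set (Fin m)) → (Empty → Fin m) → Prop, Reg P ∧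
      ∀ m X x τ, Encodes F X τ → (∀ a ∉ F, τ a = none) → (P m X x ↔ θ.Holds τ) := by
  induction θ with
  | eq a b =>
    refine ⟨_, (Reg.const (a ∈ F ∧ b ∈ F)).and ((reg_set_eq_empty a).not.and (reg_sets_eq a b)),
      fun m X x τ hX hτ => ?_⟩
    simp only [Holds, Tuple.dom, Set.mem_ofPred_eq]
    by_cases ha : a ∈ F
    · by_cases hb : b ∈ F
      · rw [hX a ha, hX b hb, setOf_eq_some_eq_empty]
        constructor
        · rintro ⟨_, h, h'⟩
          have := setOf_eq_some_injective h'
          exact ⟨h, this ▸ h, this⟩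
        · rintro ⟨h, _, h'⟩
          exact ⟨⟨ha, hb⟩, h, by rw [h']⟩
      · simp [hτ b hb, hb]
    · simp [hτ a ha, ha]
  | not θ ih =>
    obtain ⟨P, hP, h⟩ := ih
    exact ⟨_, hP.not, fun m X x τ hX hτ => not_congr (h m X x τ hX hτ)⟩
  | or θ θ' ih ih' =>
    obtain ⟨P, hP, h⟩ := ih
    obtain ⟨P', hP', h'⟩ := ih'
    exact ⟨_, hP.or hP', fun m X x τ hX hτ => or_congr (h m X x τ hX hτ) (h' m X x τ hX hτ)⟩
  | and θ θ' ih ih' =>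
    obtain ⟨P, hP, h⟩ := ih
    obtain ⟨P', hP', h'⟩ := ih'
    exact ⟨_, hP.and hP', fun m X x τ hX hτ => and_congr (h m X x τ hX hτ) (h' m X x τ hX hτ)⟩

theorem RegTable.sel (h : RegTable F T) (θ : SelCond A) :
    RegTable F fun m => {τ ∈ T m | θ.Holds τ} := by
  obtain ⟨P, hP, hθ⟩ := θ.exists_reg F
  refine ⟨fun m τ hτ => h.1 m τ hτ.1, (h.2.and hP).congr fun m X x => ?_⟩
  constructor
  · rintro ⟨τ, hτ, hX⟩
    exact ⟨⟨τ, hτ.1, hX⟩, (hθ m X x τ hX (h.1 m τ hτ.1)).mpr hτ.2⟩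
  · rintro ⟨⟨τ, hτ, hX⟩, hPX⟩
    exact ⟨τ, ⟨hτ, (hθ m X x τ hX (h.1 m τ hτ)).mp hPX⟩, hX⟩

theorem RegTable.undefined (h : RegTable F T) (b : A) :
    RegTable F fun m => {τ ∈ T m | b ∉ τ.dom} := by
  refine ⟨fun m τ hτ => h.1 m τ hτ.1,
    (h.2.and ((Reg.const (b ∉ F)).or (reg_set_eq_empty b))).congr fun m X x => ?_⟩
  simp only [Tuple.dom, Set.mem_ofPred_eq, not_not]
  constructor
  · rintro ⟨τ, ⟨hτ, hb⟩, hX⟩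
    refine ⟨⟨τ, hτ, hX⟩, ?_⟩
    by_cases hbF : b ∈ F
    · right
      rw [hX b hbF, setOf_eq_some_eq_empty, hb]
    · exact .inl hbF
  · rintro ⟨⟨τ, hτ, hX⟩, hb⟩
    refine ⟨τ, ⟨hτ, ?_⟩, hX⟩
    by_cases hbF : b ∈ F
    · rcases hb with hb | hb
      · exact absurd hbF hb
      · rwa [hX b hbF, setOf_eq_some_eq_empty] at hb
    · exact h.1 m τ hτ b hbF

/-- Attributewise images of regular tables, where each value is a value of the given tuple or
undefined. -/
theorem RegTable.image_reindex (h : RegTable F T) (f : A → Option A)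
    (hf : ∀ a ∉ F, ∀ b ∈ f a, b ∉ F) (hf' : ∀ a ∈ F, ∀ b ∈ f a, b ∈ F) :
    RegTable F fun m => (fun τ a => (f a).bind τ) '' T m := by
  refine ⟨?_, ?_⟩
  · rintro m _ ⟨τ, hτ, rfl⟩ a ha
    show (f a).bind τ = none
    cases hfa : f a with
    | none => rfl
    | some b => exact h.1 m τ hτ b (hf a ha b hfa)
  · have key : ∀ a, Reg fun m (X : A ⊕ A → Set (Fin m)) (_ : Empty → Fin m) =>
        X (.inl a) = (f a).elim ∅ fun b => X (.inr b) := by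
      intro a
      cases f a with
      | none => exact reg_set_eq_empty _
      | some b => exact reg_sets_eq _ _
    refine (Reg.exists_sets (P := fun m X Y _ => (∃ τ ∈ T m, Encodes F Y τ) ∧
      ∀ a ∈ F, X a = (f a).elim ∅ fun b => Y b) ((h.2.comap Sum.inr id).and
        (Reg.forall_mem_finset F fun a _ => key a))).congr fun m X _ => ?_
    constructor
    · rintro ⟨_, ⟨τ, hτ, rfl⟩, hX⟩
      refine ⟨fun a => {j | τ a = some j}, ⟨τ, hτ, encodes_self F τ⟩, fun a ha => ?_⟩
      rw [hX a ha]
      show {j | (f a).bind τ = some j} = _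
      cases f a <;> simp
    · rintro ⟨Y, ⟨τ, hτ, hY⟩, hX⟩
      refine ⟨_, ⟨τ, hτ, rfl⟩, fun a ha => ?_⟩
      rw [hX a ha]
      show _ = {j | (f a).bind τ = some j}
      cases hfa : f a with
      | none => simp
      | some b => exact hY b (hf' a ha b hfa)

theorem RegTable.restrict (h : RegTable F T) (B : Set A) :
    RegTable F fun m => (fun τ : Tuple A (Fin m) => τ.restrict B) '' T m := by
  convert h.image_reindex (fun a => if a ∈ B then some a else none) ?_ ?_ using 5 with m τ _ a
  · unfold Tuple.restrict
    split_ifs <;> rfl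
  · intro a ha b hb
    simp at hb
    exact hb.2 ▸ ha
  · intro a ha b hb
    simp at hb
    exact hb.2 ▸ ha

theorem RegTable.rename (h : RegTable F T) (a b : A) :
    RegTable (insert a (insert b F)) fun m => Tuple.rename a b '' T m := by
  have h' : RegTable (insert a (insert b F)) T :=
    h.mono fun c hc => Finset.mem_insert_of_mem (Finset.mem_insert_of_mem hc)
  convert h'.image_reindex
    (fun c => if c = b then some a else if c = a then none else some c) ?_ ?_ using 5 with m τ _ c
  · unfold Tuple.rename
    split_ifs <;> rfl
  · intro c hc d hd
    simp only [Finset.mem_insert, not_or] at hc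
    simp [hc.1, hc.2.1] at hd
    subst hd
    simp [hc]
  · intro c hc d hd
    simp only [Option.mem_def] at hd
    split_ifs at hd <;> cases hd <;> simp_all

theorem RegTable.natJoin (h : RegTable F T) (h' : RegTable F T') :
    RegTable F fun m => Tuple.natJoin (T m) (T' m) := by
  refine ⟨?_, ?_⟩
  · rintro m _ ⟨μ, hμ, ν, hν, _, rfl⟩ a ha
    simp [Tuple.join, h.1 m μ hμ a ha, h'.1 m ν hν a ha]
  · have key : ∀ a, Reg fun m (X : (A ⊕ A) ⊕ A → Set (Fin m)) (_ : Empty → Fin m) =>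
        (X (.inl (.inr a)) = ∅ ∧ X (.inl (.inl a)) = X (.inr a)) ∨
        (X (.inl (.inr a)) ≠ ∅ ∧ X (.inl (.inl a)) = X (.inl (.inr a)) ∧
          (X (.inr a) = ∅ ∨ X (.inl (.inr a)) = X (.inr a))) := fun a =>
      ((reg_set_eq_empty _).and (reg_sets_eq _ _)).or ((reg_set_eq_empty _).not.and
        ((reg_sets_eq _ _).and ((reg_set_eq_empty _).or (reg_sets_eq _ _))))
    have hreg : Reg fun m (X : A ⊕ A → Set (Fin m)) (_ : Empty → Fin m) =>
        ∃ Z : A → Set (Fin m), (∃ μ ∈ T m, Encodes F (fun a => X (.inr a)) μ) ∧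
          (∃ ν ∈ T' m, Encodes F Z ν) ∧
          ∀ a ∈ F, (X (.inr a) = ∅ ∧ X (.inl a) = Z a) ∨
            (X (.inr a) ≠ ∅ ∧ X (.inl a) = X (.inr a) ∧ (Z a = ∅ ∨ X (.inr a) = Z a)) :=
      Reg.exists_sets ((h.2.comap (fun a => .inl (.inr a)) id).and ((h'.2.comap Sum.inr id).and
        (Reg.forall_mem_finset F fun a _ => key a)))
    replace hreg := Reg.exists_sets (P := fun m X Y (_ : Empty → Fin m) =>
      ∃ Z : A → Set (Fin m), (∃ μ ∈ T m, Encodes F Y μ) ∧ (∃ ν ∈ T' m, Encodes F Z ν) ∧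
        ∀ a ∈ F, (Y a = ∅ ∧ X a = Z a) ∨ (Y a ≠ ∅ ∧ X a = Y a ∧ (Z a = ∅ ∨ Y a = Z a))) hreg
    refine hreg.congr fun m X _ => ?_
    constructor
    · rintro ⟨_, ⟨μ, hμ, ν, hν, hμν, rfl⟩, hX⟩
      refine ⟨fun a => {j | μ a = some j}, fun a => {j | ν a = some j},
        ⟨μ, hμ, encodes_self F μ⟩, ⟨ν, hν, encodes_self F ν⟩, fun a ha => ?_⟩
      rw [hX a ha, Ne, setOf_eq_some_eq_empty, setOf_eq_some_eq_empty]
      by_cases hμa : μ a = none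
      · left
        simp [Tuple.join, Tuple.dom, hμa]
      · right
        refine ⟨hμa, by simp [Tuple.join, Tuple.dom, hμa], ?_⟩
        by_cases hνa : ν a = none
        · exact .inl hνa
        · exact .inr (congrArg (fun o => {j | o = some j}) (hμν a ⟨hμa, hνa⟩))
    · rintro ⟨Y, Z, ⟨μ, hμ, hY⟩, ⟨ν, hν, hZ⟩, hX⟩
      have hX' : ∀ a ∈ F, (μ a = none ∧ X a = {j | ν a = some j}) ∨
          (μ a ≠ none ∧ X a = {j | μ a = some j} ∧ (ν a = none ∨ μ a = ν a)) := by
        intro a ha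
        have := hX a ha
        rw [hY a ha, hZ a ha, Ne, setOf_eq_some_eq_empty, setOf_eq_some_eq_empty] at this
        exact this.imp id fun h => ⟨h.1, h.2.1, h.2.2.imp id setOf_eq_some_injective⟩
      refine ⟨_, ⟨μ, hμ, ν, hν, ?_, rfl⟩, fun a ha => ?_⟩
      · rintro a ⟨ha, ha'⟩
        have haF : a ∈ F := by
          by_contra hn
          exact ha (h.1 m μ hμ a hn)
        rcases hX' a haF with ⟨h, _⟩ | ⟨_, _, h | h⟩
        · exact absurd h ha
        · exact absurd h ha'
        · exact h
      · rcases hX' a ha with ⟨h, h'⟩ | ⟨h, h', _⟩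
        · rw [h']
          simp [Tuple.join, Tuple.dom, h]
        · rw [h']
          simp [Tuple.join, Tuple.dom, h]

theorem RegTable.nil : RegTable (∅ : Finset A) fun m => ({Tuple.nil} : Set (Tuple A (Fin m))) := by
  refine ⟨?_, (Reg.const True).congr fun m X _ => ?_⟩
  · rintro m _ rfl a _
    rfl
  · exact iff_of_true ⟨_, rfl, by simp [Encodes]⟩ trivial

/-- Regular families of tables. -/
def IsRegTable (T : ∀ m : ℕ, Set (Tuple A (Fin m))) : Prop := ∃ F, RegTable F T

theorem IsRegTable.exists_common (h : IsRegTable T) (h' : IsRegTable T') :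
    ∃ F, RegTable F T ∧ RegTable F T' := by
  obtain ⟨F, h⟩ := h
  obtain ⟨F', h'⟩ := h'
  exact ⟨F ∪ F', h.mono Finset.subset_union_left, h'.mono Finset.subset_union_right⟩

theorem IsRegTable.union (h : IsRegTable T) (h' : IsRegTable T') :
    IsRegTable fun m => T m ∪ T' m :=
  let ⟨F, h, h'⟩ := h.exists_common h'
  ⟨F, h.union h'⟩

theorem IsRegTable.inter (h : IsRegTable T) (h' : IsRegTable T') :
    IsRegTable fun m => T m ∩ T' m :=
  let ⟨F, h, h'⟩ := h.exists_common h'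
  ⟨F, h.inter h'⟩

theorem IsRegTable.diff (h : IsRegTable T) (h' : IsRegTable T') :
    IsRegTable fun m => T m \ T' m :=
  let ⟨F, h, h'⟩ := h.exists_common h'
  ⟨F, h.diff h'⟩

theorem IsRegTable.natJoin (h : IsRegTable T) (h' : IsRegTable T') :
    IsRegTable fun m => Tuple.natJoin (T m) (T' m) :=
  let ⟨F, h, h'⟩ := h.exists_common h'
  ⟨F, h.natJoin h'⟩

variable {S : Type*} {D : ∀ m : ℕ, S → Set (Tuple A (Fin m))}

theorem RA.isRegTable_eval (hD : ∀ s, IsRegTable fun m => D m s) (Q : RA S A) :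
    IsRegTable fun m => Q.eval (D m) := by
  induction Q with
  | rel s => exact hD s
  | proj B Q ih => exact ih.imp fun _ h => h.restrict B
  | sel θ Q ih => exact ih.imp fun _ h => h.sel θ
  | ren a b Q ih => exact let ⟨_, h⟩ := ih; ⟨_, h.rename a b⟩
  | join Q Q' ih ih' => exact ih.natJoin ih'
  | union Q Q' ih ih' => exact ih.union ih'
  | inter Q Q' ih ih' => exact ih.inter ih'
  | diff Q Q' ih ih' => exact ih.diff ih'

mutual

theorem LCRA.Clause.isRegTable_eval (hD : ∀ s, IsRegTable fun m => D m s) :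
    ∀ (L : LCRA.Clause S A) (T : ∀ m : ℕ, Set (Tuple A (Fin m))), IsRegTable T →
      IsRegTable fun m => L.eval (D m) (T m)
  | .rel s, T, hT => by simpa only [LCRA.Clause.eval] using hT.natJoin (hD s)
  | .proj B, T, hT => by
    obtain ⟨_, h⟩ := hT
    simpa only [LCRA.Clause.eval] using ⟨_, h.restrict B⟩
  | .sel θ, T, hT => by
    obtain ⟨_, h⟩ := hT
    simpa only [LCRA.Clause.eval] using ⟨_, h.sel θ⟩
  | .ren a b, T, hT => by
    obtain ⟨_, h⟩ := hT
    simpa only [LCRA.Clause.eval] using ⟨_, (h.undefined b).rename a b⟩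
  | .seq L L', T, hT => by
    simpa only [LCRA.Clause.eval] using
      LCRA.Clause.isRegTable_eval hD L' _ (LCRA.Clause.isRegTable_eval hD L T hT)
  | .call Q, T, hT => by
    simpa only [LCRA.Clause.eval] using hT.natJoin (LCRA.Query.isRegTable_eval hD Q T hT)

theorem LCRA.Query.isRegTable_eval (hD : ∀ s, IsRegTable fun m => D m s) :
    ∀ (Q : LCRA.Query S A) (T : ∀ m : ℕ, Set (Tuple A (Fin m))), IsRegTable T →
      IsRegTable fun m => Q.eval (D m) (T m)
  | .clause L, T, hT => by
    simpa only [LCRA.Query.eval] using LCRA.Clause.isRegTable_eval hD L T hT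
  | .inter Q Q', T, hT => by
    simpa only [LCRA.Query.eval] using
      (LCRA.Query.isRegTable_eval hD Q T hT).inter (LCRA.Query.isRegTable_eval hD Q' T hT)
  | .union Q Q', T, hT => by
    simpa only [LCRA.Query.eval] using
      (LCRA.Query.isRegTable_eval hD Q T hT).union (LCRA.Query.isRegTable_eval hD Q' T hT)
  | .diff Q Q', T, hT => by
    simpa only [LCRA.Query.eval] using
      (LCRA.Query.isRegTable_eval hD Q T hT).diff (LCRA.Query.isRegTable_eval hD Q' T hT)

end

theorem IsRegTable.periodic {T : ∀ m : ℕ, Set (Tuple A (Fin m))} (h : IsRegTable T) :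
    ∃ t p : ℕ, 0 < p ∧ ∀ n, t ≤ n →
      ((T (2 * n + 1)).Nonempty ↔ (T (2 * (n + p) + 1)).Nonempty) := by
  obtain ⟨F, -, hF⟩ := h
  refine Reg.periodic (α := Empty) (P := fun m => (T m).Nonempty) ?_
  refine (Reg.exists_sets (P := fun m (_ : Empty → Set (Fin m)) X (_ : Empty → Fin m) =>
    ∃ τ ∈ T m, Encodes F X τ) (hF.comap Sum.inr id)).congr fun m X _ => ?_
  constructor
  · rintro ⟨τ, hτ⟩
    exact ⟨_, τ, hτ, encodes_self F τ⟩
  · rintro ⟨_, τ, hτ, _⟩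
    exact ⟨τ, hτ⟩

end Tables

/-! ## Renaming values -/

section Transport

variable {A U U' S : Type*}

/-- The tuple obtained by applying `f` to all values. -/
def Tuple.mapVal (f : U → U') (τ : Tuple A U) : Tuple A U' := fun a => (τ a).map f

theorem Tuple.mapVal_nil (f : U → U') : (Tuple.nil : Tuple A U).mapVal f = Tuple.nil := rfl

theorem Tuple.mapVal_injective {f : U → U'} (hf : Function.Injective f) :
    Function.Injective (Tuple.mapVal f : Tuple A U → Tuple A U') := fun _ _ h =>
  funext fun a => Option.map_injective hf (congrFun h a)

theorem Tuple.dom_mapVal (f : U → U') (τ : Tuple A U) : (τ.mapVal f).dom = τ.dom := by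
  ext a
  simp [dom, mapVal]

theorem Tuple.restrict_mapVal (f : U → U') (τ : Tuple A U) (B : Set A) :
    (τ.mapVal f).restrict B = (τ.restrict B).mapVal f := by
  funext a
  simp only [restrict, mapVal]
  split_ifs <;> rfl

theorem Tuple.rename_mapVal (f : U → U') (τ : Tuple A U) (a b : A) :
    (τ.mapVal f).rename a b = (τ.rename a b).mapVal f := by
  funext c
  simp only [rename, mapVal]
  split_ifs <;> rfl

theorem Tuple.join_mapVal (f : U → U') (μ ν : Tuple A U) :
    (μ.mapVal f).join (ν.mapVal f) = (μ.join ν).mapVal f := by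
  funext c
  simp only [join, dom_mapVal]
  show _ = Option.map f (if c ∈ μ.dom then μ c else ν c)
  split_ifs <;> rfl

variable {f : U → U'}

theorem Tuple.compatible_mapVal (hf : Function.Injective f) (μ ν : Tuple A U) :
    (μ.mapVal f).Compatible (ν.mapVal f) ↔ μ.Compatible ν := by
  simp only [Compatible, dom_mapVal]
  exact forall₂_congr fun a _ => (Option.map_injective hf).eq_iff

theorem Tuple.natJoin_mapVal (hf : Function.Injective f) (R R' : Set (Tuple A U)) :
    natJoin (mapVal f '' R) (mapVal f '' R') = mapVal f '' natJoin R R' := by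
  ext τ
  constructor
  · rintro ⟨_, ⟨μ, hμ, rfl⟩, _, ⟨ν, hν, rfl⟩, h, rfl⟩
    exact ⟨_, ⟨μ, hμ, ν, hν, (compatible_mapVal hf μ ν).mp h, rfl⟩, (join_mapVal f μ ν).symm⟩
  · rintro ⟨_, ⟨μ, hμ, ν, hν, h, rfl⟩, rfl⟩
    exact ⟨_, ⟨μ, hμ, rfl⟩, _, ⟨ν, hν, rfl⟩, (compatible_mapVal hf μ ν).mpr h,
      (join_mapVal f μ ν).symm⟩

theorem SelCond.holds_mapVal (hf : Function.Injective f) (θ : SelCond A) (τ : Tuple A U) :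
    θ.Holds (τ.mapVal f) ↔ θ.Holds τ := by
  induction θ with
  | eq a b =>
    simp only [Holds, Tuple.dom_mapVal]
    exact and_congr_right' (and_congr_right' (Option.map_injective hf).eq_iff)
  | not θ ih => exact not_congr ih
  | or θ θ' ih ih' => exact or_congr ih ih'
  | and θ θ' ih ih' => exact and_congr ih ih'

theorem SelCond.sel_mapVal (hf : Function.Injective f) (θ : SelCond A) (R : Set (Tuple A U)) :
    {τ ∈ Tuple.mapVal f '' R | θ.Holds τ} = Tuple.mapVal f '' {τ ∈ R | θ.Holds τ} := by
  ext τ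
  constructor
  · rintro ⟨⟨τ, hτ, rfl⟩, h⟩
    exact ⟨τ, ⟨hτ, (θ.holds_mapVal hf τ).mp h⟩, rfl⟩
  · rintro ⟨τ, ⟨hτ, h⟩, rfl⟩
    exact ⟨⟨τ, hτ, rfl⟩, (θ.holds_mapVal hf τ).mpr h⟩

theorem Tuple.image_restrict_mapVal (B : Set A) (R : Set (Tuple A U)) :
    (fun τ : Tuple A U' => τ.restrict B) '' (mapVal f '' R) =
      mapVal f '' ((fun τ : Tuple A U => τ.restrict B) '' R) := by
  simp only [Set.image_image, restrict_mapVal]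

theorem Tuple.image_rename_mapVal (a b : A) (R : Set (Tuple A U)) :
    rename a b '' (mapVal f '' R) = mapVal f '' (rename a b '' R) := by
  simp only [Set.image_image, rename_mapVal]

theorem Tuple.undefined_mapVal (b : A) (R : Set (Tuple A U)) :
    {τ ∈ mapVal f '' R | b ∉ τ.dom} = mapVal f '' {τ ∈ R | b ∉ τ.dom} := by
  ext τ
  constructor
  · rintro ⟨⟨τ, hτ, rfl⟩, h⟩
    exact ⟨τ, ⟨hτ, by rwa [dom_mapVal] at h⟩, rfl⟩
  · rintro ⟨τ, ⟨hτ, h⟩, rfl⟩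
    exact ⟨⟨τ, hτ, rfl⟩, by rwa [dom_mapVal]⟩

variable {D : S → Set (Tuple A U)} {D' : S → Set (Tuple A U')}

theorem RA.eval_mapVal (hf : Function.Injective f) (hD : ∀ s, D' s = Tuple.mapVal f '' D s) (Q : RA S A) :
    Q.eval D' = Tuple.mapVal f '' Q.eval D := by
  have hinj := Tuple.mapVal_injective (A := A) hf
  induction Q with
  | rel s => exact hD s
  | proj B Q ih => simp only [eval, ih, Tuple.image_restrict_mapVal]
  | sel θ Q ih => simp only [eval, ih, θ.sel_mapVal hf]
  | ren a b Q ih => simp only [eval, ih, Tuple.image_rename_mapVal]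
  | join Q Q' ih ih' => simp only [eval, ih, ih', Tuple.natJoin_mapVal hf]
  | union Q Q' ih ih' => simp only [eval, ih, ih', Set.image_union]
  | inter Q Q' ih ih' => simp only [eval, ih, ih', Set.image_inter hinj]
  | diff Q Q' ih ih' => simp only [eval, ih, ih', Set.image_sdiff hinj]

mutual

theorem LCRA.Clause.eval_mapVal (hf : Function.Injective f) (hD : ∀ s, D' s = Tuple.mapVal f '' D s) :
    ∀ (L : LCRA.Clause S A) (R : Set (Tuple A U)),
      L.eval D' (Tuple.mapVal f '' R) = Tuple.mapVal f '' L.eval D R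
  | .rel s, R => by simp only [LCRA.Clause.eval, hD, Tuple.natJoin_mapVal hf]
  | .proj B, R => by simp only [LCRA.Clause.eval, Tuple.image_restrict_mapVal]
  | .sel θ, R => by simp only [LCRA.Clause.eval, θ.sel_mapVal hf]
  | .ren a b, R => by
    simp only [LCRA.Clause.eval, Tuple.undefined_mapVal, Tuple.image_rename_mapVal]
  | .seq L L', R => by
    simp only [LCRA.Clause.eval, LCRA.Clause.eval_mapVal hf hD L, LCRA.Clause.eval_mapVal hf hD L']
  | .call Q, R => by
    simp only [LCRA.Clause.eval, LCRA.Query.eval_mapVal hf hD Q, Tuple.natJoin_mapVal hf]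

theorem LCRA.Query.eval_mapVal (hf : Function.Injective f) (hD : ∀ s, D' s = Tuple.mapVal f '' D s) :
    ∀ (Q : LCRA.Query S A) (R : Set (Tuple A U)),
      Q.eval D' (Tuple.mapVal f '' R) = Tuple.mapVal f '' Q.eval D R
  | .clause L, R => by simp only [LCRA.Query.eval, LCRA.Clause.eval_mapVal hf hD L]
  | .inter Q Q', R => by
    simp only [LCRA.Query.eval, LCRA.Query.eval_mapVal hf hD Q, LCRA.Query.eval_mapVal hf hD Q',
      Set.image_inter (Tuple.mapVal_injective hf)]
  | .union Q Q', R => by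
    simp only [LCRA.Query.eval, LCRA.Query.eval_mapVal hf hD Q, LCRA.Query.eval_mapVal hf hD Q',
      Set.image_union]
  | .diff Q Q', R => by
    simp only [LCRA.Query.eval, LCRA.Query.eval_mapVal hf hD Q, LCRA.Query.eval_mapVal hf hD Q',
      Set.image_sdiff (Tuple.mapVal_injective hf)]

end

theorem LCRA.Query.output_mapVal (hf : Function.Injective f) (hD : ∀ s, D' s = Tuple.mapVal f '' D s) (Q : LCRA.Query S A) :
    Q.output D' = Tuple.mapVal f '' Q.output D := by
  have := LCRA.Query.eval_mapVal hf hD Q {Tuple.nil}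
  rwa [Set.image_singleton, Tuple.mapVal_nil] at this

end Transport

end

end GraphQL

namespace GraphQL

open scoped Classical

noncomputable section

/-! ## Queries on dataless paths -/

section Queries

variable {V N E L K C : Type*}

/-- The sets of values returned for an attribute. -/
def PatternOut.row (R : PatternOut V L K) {m : ℕ} (X : V → Set (Fin m)) : Attr V K → Set (Fin m)
  | .out (.var x) => if OutItem.var x ∈ R.out then X x else ∅
  | .out (.prop _ _) => ∅
  | .name _ => ∅

/-- The table of a pattern with output on a dataless path, with values replaced by positions. -/
def PatternOut.table (first last : L) (m : ℕ) (R : PatternOut V L K) :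
    Set (Tuple (Attr V K) (Fin m)) :=
  {τ | (∀ o ∈ R.out, ∃ x, o = .var x) ∧ ∃ X s t, R.pattern.atPositions first last m X s t ∧
    ∀ a, R.row X a = {j | τ a = some j}}

theorem PatternOut.isRegTable_table (first last : L) (R : PatternOut V L K) :
    IsRegTable fun m => R.table first last m := by
  refine ⟨(R.out.map Attr.out).toFinset, ?_, ?_⟩
  · rintro m τ ⟨_, X, s, t, _, h⟩ a ha
    rw [← setOf_eq_some_eq_empty, ← h a]
    simp only [List.mem_toFinset, List.mem_map, not_exists, not_and] at ha
    rcases a with (x | ⟨x, k⟩) | i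
    · exact if_neg fun hx => ha _ hx rfl
    · rfl
    · rfl
  · have key : ∀ a, Reg fun m (X : Attr V K ⊕ V → Set (Fin m)) (_ : Empty → Fin m) =>
        X (.inl a) = R.row (fun x => X (.inr x)) a := by
      rintro ((x | ⟨x, k⟩) | i)
      · by_cases hx : OutItem.var x ∈ R.out
        · simp only [row, if_pos hx]
          exact reg_sets_eq _ _
        · simp only [row, if_neg hx]
          exact reg_set_eq_empty _
      · exact reg_set_eq_empty _
      · exact reg_set_eq_empty _
    have hpat : Reg fun m (X : Attr V K ⊕ V → Set (Fin m)) (_ : Empty → Fin m) =>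
        ∃ s t, R.pattern.atPositions first last m (fun x => X (.inr x)) s t := by
      refine Reg.exists_elem (P := fun m (X : Attr V K ⊕ V → Set (Fin m)) (_ : Empty → Fin m) s =>
        ∃ t, R.pattern.atPositions first last m (fun x => X (.inr x)) s t) ?_
      refine Reg.exists_elem (P := fun m (X : Attr V K ⊕ V → Set (Fin m))
        (z : Option Empty → Fin m) t =>
          R.pattern.atPositions first last m (fun x => X (.inr x)) (z none) t) ?_
      exact (R.pattern.regRel_atPositions first last).apply Sum.inr (some none) none
    refine ((Reg.const (∀ o ∈ R.out, ∃ x, o = OutItem.var x)).and (Reg.exists_sets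
      (P := fun m (X : Attr V K → Set (Fin m)) Y (_ : Empty → Fin m) =>
        (∃ s t, R.pattern.atPositions first last m Y s t) ∧
          ∀ a ∈ (R.out.map Attr.out).toFinset, X a = R.row Y a)
      (hpat.and (Reg.forall_mem_finset _ fun a _ => key a)))).congr fun m X _ => ?_
    constructor
    · rintro ⟨τ, ⟨hvar, Y, s, t, h, hτ⟩, hX⟩
      exact ⟨hvar, Y, ⟨s, t, h⟩, fun a ha => by rw [hX a ha, hτ a]⟩
    · rintro ⟨hvar, Y, ⟨s, t, h⟩, hX⟩
      have : ∀ a, ∃ o : Option (Fin m), R.row Y a = {j | o = some j} := by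
        rintro ((x | ⟨x, k⟩) | i)
        · by_cases hx : OutItem.var x ∈ R.out
          · obtain ⟨j, hj⟩ := Pattern.atPositions_singleton R.wf h x (R.out_fv _ hx)
            refine ⟨some j, ?_⟩
            simp only [row, if_pos hx, hj]
            ext i
            simp [eq_comm]
          · exact ⟨none, by simp [row, hx]⟩
        · exact ⟨none, by simp [row]⟩
        · exact ⟨none, by simp [row]⟩
      choose τ hτ using this
      exact ⟨τ, ⟨hvar, Y, s, t, h, hτ⟩, fun a ha => by rw [hX a ha, hτ a]⟩

variable {n : ℕ} {v : Fin (n + 1) → N} {e : Fin n → E} {first last : L}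
  {G : PropertyGraph N E L K C}

theorem PatternOut.eval_eq [LinearOrder C] (hG : IsListing first last G v e)
    (R : PatternOut V L K) :
    R.eval G = Tuple.mapVal (elementAt v e) '' R.table first last (2 * n + 1) := by
  have hinj := elementAt_injective (C := C) hG.node_inj hG.edge_inj
  have hrow : ∀ {X : V → Set (Fin (2 * n + 1))} {μ : Tuple V (Value N E C)},
      Matches v e R.pattern.fv X μ → ∀ (τ : Tuple (Attr V K) (Fin (2 * n + 1))) a,
      (∀ o ∈ R.out, ∃ x, o = .var x) → OnPath v e R.pattern.fv μ →
      (R.row X a = {j | τ a = some j} ↔ τ.mapVal (elementAt v e) a = outTuple G μ R.out a) := by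
    rintro X μ hX τ ((x | ⟨x, k⟩) | i) hvar hμ
    · simp only [row, outTuple, OutItem.value, Tuple.mapVal]
      by_cases hx : OutItem.var x ∈ R.out
      · rw [if_pos hx, if_pos hx, hX x (R.out_fv _ hx)]
        rcases hμ x with ⟨_, j, hj⟩ | ⟨h, _⟩
        · have : {i | μ x = some (elementAt v e i)} = {i | some j = some i} := by
            ext i
            simp [hj, hinj.eq_iff]
          rw [this, hj, ← Option.map_some, (Option.map_injective hinj).eq_iff]
          exact ⟨fun h => (setOf_eq_some_injective h).symm, fun h => by rw [h]⟩
        · exact absurd (R.out_fv _ hx) h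
      · rw [if_neg hx, if_neg hx, eq_comm, setOf_eq_some_eq_empty, Option.map_eq_none_iff]
    · have hx : OutItem.prop x k ∉ R.out := by
        intro h
        obtain ⟨y, hy⟩ := hvar _ h
        cases hy
      simp only [row, outTuple, if_neg hx, Tuple.mapVal]
      rw [eq_comm, setOf_eq_some_eq_empty, Option.map_eq_none_iff]
    · simp only [row, outTuple, Tuple.mapVal]
      rw [eq_comm, setOf_eq_some_eq_empty, Option.map_eq_none_iff]
  ext τ
  constructor
  · rintro ⟨p, μ, h, hdef, rfl⟩
    obtain ⟨hμ, hlast⟩ := Pattern.eval_onPath hG R.wf _ h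
    have hvar : ∀ o ∈ R.out, ∃ x, o = .var x := by
      rintro (x | ⟨x, k⟩) ho
      · exact ⟨x, rfl⟩
      · refine absurd ?_ (hdef _ ho)
        simp [OutItem.value, hμ.propAt hG]
    have hex : ∀ a, ∃ o : Option (Fin (2 * n + 1)),
        o.map (elementAt v e) = outTuple G μ R.out a := by
      rintro ((x | ⟨x, k⟩) | i)
      · simp only [outTuple, OutItem.value]
        split_ifs
        · rcases hμ x with ⟨_, j, hj⟩ | ⟨_, h⟩
          · exact ⟨some j, hj.symm⟩
          · exact ⟨none, h.symm⟩
        · exact ⟨none, rfl⟩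
      · refine ⟨none, ?_⟩
        simp [outTuple, OutItem.value, hμ.propAt hG]
      · exact ⟨none, rfl⟩
    choose τ hτ using hex
    obtain ⟨s, t, hst⟩ := Pattern.exists_ends hG R.wf h
    refine ⟨τ, ⟨hvar, fun x => {j | μ x = some (elementAt v e j)}, s, t,
      (Pattern.atPositions_iff hG R.wf _ s t).mpr ⟨_, h, hst, fun _ _ => rfl⟩, fun a => ?_⟩,
      funext hτ⟩
    exact (hrow (fun _ _ => rfl) τ a hvar hμ).mpr (hτ a)
  · rintro ⟨τ, ⟨hvar, X, s, t, h, hτ⟩, rfl⟩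
    obtain ⟨⟨p, μ⟩, hp, hst, hX⟩ := (Pattern.atPositions_iff hG R.wf X s t).mp h
    obtain ⟨hμ, -⟩ := Pattern.eval_onPath hG R.wf _ hp
    refine ⟨p, μ, hp, fun o ho => ?_, funext fun a => (hrow hX τ a hvar hμ).mp (hτ a)⟩
    obtain ⟨x, rfl⟩ := hvar o ho
    rcases hμ x with ⟨_, j, hj⟩ | ⟨h, _⟩
    · show μ x ≠ none
      rw [show μ x = _ from hj]
      exact Option.some_ne_none _
    · exact absurd (R.out_fv _ ho) h

theorem definesLengths_of_table {q : PropertyGraph N E L K C → Prop} {A : Type*}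
    {T : ∀ m : ℕ, Set (Tuple A (Fin m))} (hT : IsRegTable T)
    (h : ∀ (n : ℕ) (G : PropertyGraph N E L K C), IsDatalessPath first last n G →
      (q G ↔ (T (2 * n + 1)).Nonempty)) :
    ∃ B : Set ℕ, DefinesLengths first last q B ∧
      (∅ : Set ℕ).Definable₁ FirstOrder.Language.presburger B ∧
      IsSemilinearSet B ∧ UltimatelyPeriodic B := by
  obtain ⟨t, p, hp, hper⟩ := hT.periodic
  refine ⟨{n | (T (2 * n + 1)).Nonempty}, fun n _ G hG => h n G hG, ?_, ?_,
    t, p, hp, fun n hn => hper n hn.le⟩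
  · exact FirstOrder.Language.presburger.definable₁_iff_ultimately_periodic.mpr
      ⟨t, p, hp, fun n hn => hper n hn⟩
  · exact Nat.isSemilinearSet_iff_ultimately_periodic.mpr ⟨t, p, hp, fun n hn => hper n hn⟩

theorem CoreGQL.exists_lengths [LinearOrder C] (first last : L) (Q : CoreGQL V L K) :
    ∃ B : Set ℕ, DefinesLengths first last
      (fun G : PropertyGraph N E L K C => (Q.result G).Nonempty) B ∧
      (∅ : Set ℕ).Definable₁ FirstOrder.Language.presburger B ∧
      IsSemilinearSet B ∧ UltimatelyPeriodic B := by
  refine definesLengths_of_table (LCRA.Query.isRegTable_eval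
    (fun R => R.isRegTable_table first last) Q _ ⟨_, RegTable.nil⟩) fun n G hG => ?_
  obtain ⟨v, e, hG⟩ := hG.exists_listing
  show (LCRA.Query.output Q (PatternOut.eval G)).Nonempty ↔ _
  rw [LCRA.Query.output_mapVal (elementAt_injective hG.node_inj hG.edge_inj)
    (fun R => R.eval_eq hG), Set.image_nonempty]
  rfl

theorem CorePGQ.exists_lengths [LinearOrder C] (first last : L) (Q : CorePGQ V L K) :
    ∃ B : Set ℕ, DefinesLengths first last
      (fun G : PropertyGraph N E L K C => (Q.result G).Nonempty) B ∧
      (∅ : Set ℕ).Definable₁ FirstOrder.Language.presburger B ∧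
      IsSemilinearSet B ∧ UltimatelyPeriodic B := by
  refine definesLengths_of_table (RA.isRegTable_eval
    (fun R => R.isRegTable_table first last) Q.1) fun n G hG => ?_
  obtain ⟨v, e, hG⟩ := hG.exists_listing
  show (RA.eval (PatternOut.eval G) Q.1).Nonempty ↔ _
  rw [RA.eval_mapVal (elementAt_injective hG.node_inj hG.edge_inj)
    (fun R => R.eval_eq hG), Set.image_nonempty]

/-- There are dataless paths of all lengths. -/
theorem exists_isDatalessPath (N E K C : Type*) [Infinite N] [Infinite E] (first last : L) (n : ℕ) :
    ∃ G : PropertyGraph N E L K C, IsDatalessPath first last n G := by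
  let v : ℕ ↪ N := Infinite.natEmbedding N
  let e : ℕ ↪ E := Infinite.natEmbedding E
  have hinv : ∀ i, Function.invFun e (e i) = i := Function.leftInverse_invFun e.injective
  refine ⟨{
    nodes := (Finset.range (n + 1)).map v
    edges := (Finset.range n).map e
    lab := Sum.elim (fun x => (if x = v 0 then {first} else ∅) ∪ (if x = v n then {last} else ∅))
      fun _ => ∅
    src := fun y => v (Function.invFun e y)
    tgt := fun y => v (Function.invFun e y + 1)
    prop := fun _ _ => none
    src_mem := ?_
    tgt_mem := ?_ }, fun i => v i, fun i => e i, ?_, ?_, ?_, ?_, ?_, ?_, ?_, ?_, ?_⟩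
  · intro y hy
    obtain ⟨i, hi, rfl⟩ := Finset.mem_map.mp hy
    rw [Finset.mem_range] at hi
    simp only [hinv, Finset.mem_map', Finset.mem_range]
    omega
  · intro y hy
    obtain ⟨i, hi, rfl⟩ := Finset.mem_map.mp hy
    rw [Finset.mem_range] at hi
    simp only [hinv, Finset.mem_map', Finset.mem_range]
    omega
  · exact fun i j h => Fin.ext (v.injective h)
  · exact fun i j h => Fin.ext (e.injective h)
  · intro x
    simp [Fin.exists_iff, eq_comm]
  · intro y
    simp [Fin.exists_iff, eq_comm]
  · intro i
    simp [hinv]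
  · intro i l
    have h0 : v i = v 0 ↔ i = 0 := by
      rw [v.injective.eq_iff, Fin.ext_iff]
      rfl
    have h1 : v i = v n ↔ i = Fin.last n := by
      rw [v.injective.eq_iff, Fin.ext_iff]
      rfl
    simp only [Sum.elim_inl, Finset.mem_union, h0, h1]
    split_ifs <;> simp_all
  · intro i
    rfl
  · intro i k
    rfl
  · intro i k
    rfl

theorem not_ultimatelyPeriodic_powers {B : Set ℕ} (hB : UltimatelyPeriodic B)
    (h : ∀ n, 0 < n → (n ∈ B ↔ ∃ k : ℕ, n = 2 ^ k)) : False := by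
  obtain ⟨t, p, hp, hper⟩ := hB
  have hlt : t + p < 2 ^ (t + p) := Nat.lt_two_pow_self
  have hmem := (hper (2 ^ (t + p)) (by omega)).mp ((h _ (by positivity)).mpr ⟨_, rfl⟩)
  obtain ⟨k, hk⟩ := (h _ (by positivity)).mp hmem
  have h1 : 2 ^ (t + p) < 2 ^ k := by omega
  have h2 : 2 ^ k < 2 ^ (t + p + 1) := by rw [pow_succ]; omega
  rw [Nat.pow_lt_pow_iff_right (by norm_num)] at h1 h2
  omega

theorem not_definesLengths_powers [Infinite N] [Infinite E]
    {q : PropertyGraph N E L K C → Prop}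
    (hq : ∃ B : Set ℕ, DefinesLengths first last q B ∧
      (∅ : Set ℕ).Definable₁ FirstOrder.Language.presburger B ∧
      IsSemilinearSet B ∧ UltimatelyPeriodic B) :
    ¬ DefinesLengths first last q {n | ∃ k : ℕ, n = 2 ^ k} := by
  obtain ⟨B, hB, _, _, hper⟩ := hq
  intro h
  refine not_ultimatelyPeriodic_powers hper fun n hn => ?_
  obtain ⟨G, hG⟩ := exists_isDatalessPath N E K C first last n
  rw [← hB n hn G hG, h n hn G hG]
  rfl

end Queries

end

end GraphQL

namespace GraphQL

noncomputable section

/-! ## A query that asks whether the length of a path is a power of two -/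

section PowerQuery

variable {N E L K C : Type*}

namespace PropertyGraph

/-- Two nodes are joined by an edge. -/
def Joined (G : PropertyGraph N E L K C) (a b : N) : Prop :=
  ∃ e ∈ G.edges, a = G.src e ∧ b = G.tgt e

/-- A node has a label. -/
def Labeled (G : PropertyGraph N E L K C) (l : L) (a : N) : Prop :=
  a ∈ G.nodes ∧ l ∈ G.lab (.inl a)

/-- On a dataless path with nodes `v₀, …, vₙ` this relation holds the triples `(v_p, v_{p+i}, v_i)`
for powers of two `p`: the second and third components move in parallel until the third is about to
reach `v_p`, and then the second is about to reach `v_{2p}`. -/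
inductive Doubling (G : PropertyGraph N E L K C) (first : L) : N → N → N → Prop
  | init {z x x' : N} : G.Labeled first z → G.Joined z x → G.Joined z x' → Doubling G first x x' z
  | move {p x y x' y' : N} : Doubling G first p x y → G.Joined x x' → G.Joined y y' →
      Doubling G first p x' y'
  | double {p x y x' x'' z : N} : Doubling G first p x y → G.Joined y p → G.Joined x x' →
      G.Joined x x'' → G.Labeled first z → Doubling G first x' x'' z

/-- On dataless paths this Boolean query asks whether the length is a power of two. -/
def PowerLength (first last : L) (G : PropertyGraph N E L K C) : Prop :=
  ∃ p x z, G.Doubling first p x z ∧ G.Labeled first z ∧ G.Labeled last p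

end PropertyGraph

theorem IsDatalessPath.exists_nodes {first last : L} (hfl : first ≠ last) {n : ℕ}
    {G : PropertyGraph N E L K C} (h : IsDatalessPath first last n G) :
    ∃ u : ℕ → N, (∀ i j, i ≤ n → j ≤ n → u i = u j → i = j) ∧
      (∀ a b, G.Joined a b ↔ ∃ i, i < n ∧ a = u i ∧ b = u (i + 1)) ∧
      (∀ a, G.Labeled first a ↔ a = u 0) ∧ (∀ a, G.Labeled last a ↔ a = u n) := by
  obtain ⟨v, e, hG⟩ := h.exists_listing
  have hu : ∀ {i : ℕ} (hi : i < n + 1), v (Fin.ofNat (n + 1) i) = v ⟨i, hi⟩ := fun hi =>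
    congrArg v (Fin.ext (Nat.mod_eq_of_lt hi))
  refine ⟨fun i => v (Fin.ofNat (n + 1) i), fun i j hi hj h => ?_, fun a b => ?_, fun a => ?_,
    fun a => ?_⟩ <;> beta_reduce
  · simp only [hu (Nat.lt_succ_of_le hi), hu (Nat.lt_succ_of_le hj)] at h
    exact congrArg Fin.val (hG.node_inj h)
  · constructor
    · rintro ⟨y, hy, rfl, rfl⟩
      obtain ⟨i, -, hs, ht⟩ := hG.edge_cases hy
      refine ⟨i, i.2, ?_, ?_⟩
      · rw [hu (i := i) (by omega), hs]
        rfl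
      · rw [hu (i := i + 1) (by omega), ht]
        rfl
    · rintro ⟨i, hi, rfl, rfl⟩
      refine ⟨e ⟨i, hi⟩, (hG.edges _).mpr ⟨_, rfl⟩, ?_, ?_⟩
      · rw [hu (i := i) (by omega), (hG.src_tgt _).1]
        rfl
      · rw [hu (i := i + 1) (by omega), (hG.src_tgt _).2]
        rfl
  · rw [hu (Nat.succ_pos n)]
    constructor
    · rintro ⟨ha, hl⟩
      obtain ⟨i, rfl⟩ := (hG.nodes a).mp ha
      rcases (hG.lab_node i first).mp hl with ⟨rfl, _⟩ | ⟨_, h⟩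
      · rfl
      · exact absurd h hfl
    · rintro rfl
      exact ⟨(hG.nodes _).mpr ⟨_, rfl⟩, (hG.lab_node _ first).mpr (.inl ⟨rfl, rfl⟩)⟩
  · rw [hu (Nat.lt_succ_self n)]
    constructor
    · rintro ⟨ha, hl⟩
      obtain ⟨i, rfl⟩ := (hG.nodes a).mp ha
      rcases (hG.lab_node i last).mp hl with ⟨_, h⟩ | ⟨rfl, _⟩
      · exact absurd h.symm hfl
      · rfl
    · rintro rfl
      exact ⟨(hG.nodes _).mpr ⟨_, rfl⟩, (hG.lab_node _ last).mpr (.inr ⟨rfl, rfl⟩)⟩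

theorem powerLength_iff {first last : L} (hfl : first ≠ last) {n : ℕ}
    {G : PropertyGraph N E L K C} (h : IsDatalessPath first last n G) :
    G.PowerLength first last ↔ ∃ k : ℕ, n = 2 ^ k := by
  obtain ⟨u, hinj, hjoin, hfirst, hlast⟩ := h.exists_nodes hfl
  have hsucc : ∀ {i b}, i ≤ n → G.Joined (u i) b → i < n ∧ b = u (i + 1) := by
    intro i b hi h
    obtain ⟨j, hj, hij, hb⟩ := (hjoin _ _).mp h
    obtain rfl := hinj i j hi hj.le hij
    exact ⟨hj, hb⟩
  have hjoin' : ∀ {i}, i < n → G.Joined (u i) (u (i + 1)) := fun hi =>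
    (hjoin _ _).mpr ⟨_, hi, rfl, rfl⟩
  have sound : ∀ {p x y}, G.Doubling first p x y →
      ∃ k i, 2 ^ k + i ≤ n ∧ p = u (2 ^ k) ∧ x = u (2 ^ k + i) ∧ y = u i := by
    intro p x y h
    induction h with
    | init hz hx hx' =>
      obtain rfl := (hfirst _).mp hz
      obtain ⟨h0, rfl⟩ := hsucc (Nat.zero_le n) hx
      obtain ⟨_, rfl⟩ := hsucc (Nat.zero_le n) hx'
      exact ⟨0, 0, h0, rfl, rfl, rfl⟩
    | move _ hx hy ih =>
      obtain ⟨k, i, hi, rfl, rfl, rfl⟩ := ih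
      obtain ⟨h, rfl⟩ := hsucc hi hx
      obtain ⟨_, rfl⟩ := hsucc (le_trans (Nat.le_add_left _ _) hi) hy
      exact ⟨k, i + 1, h, rfl, rfl, rfl⟩
    | double _ hy hx hx' hz ih =>
      obtain ⟨k, i, hi, rfl, rfl, rfl⟩ := ih
      obtain ⟨_, hp⟩ := hsucc (le_trans (Nat.le_add_left _ _) hi) hy
      obtain ⟨h, rfl⟩ := hsucc hi hx
      obtain ⟨_, rfl⟩ := hsucc hi hx'
      obtain rfl := (hfirst _).mp hz
      have hpi : 2 ^ k = i + 1 := hinj _ _ (by omega) (by omega) hp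
      have hk : 2 ^ k + i + 1 = 2 ^ (k + 1) := by rw [pow_succ]; omega
      exact ⟨k + 1, 0, by omega, by rw [hk], by rw [hk]; rfl, rfl⟩
  have complete : ∀ {k}, G.Doubling first (u (2 ^ k)) (u (2 ^ k)) (u 0) → ∀ i, 2 ^ k + i ≤ n →
      G.Doubling first (u (2 ^ k)) (u (2 ^ k + i)) (u i) := by
    intro k h i
    induction i with
    | zero => exact fun _ => h
    | succ i ih =>
      intro hi
      have hpos : 0 < 2 ^ k := by positivity
      exact (ih (by omega)).move (hjoin' (i := 2 ^ k + i) (by omega)) (hjoin' (by omega))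
  constructor
  · rintro ⟨p, x, z, h, hz, hp⟩
    obtain ⟨k, i, hi, rfl, rfl, rfl⟩ := sound h
    exact ⟨k, (hinj _ _ (by omega) le_rfl ((hlast _).mp hp)).symm⟩
  · rintro ⟨k, hk⟩
    have : ∀ k, 2 ^ k ≤ n → G.Doubling first (u (2 ^ k)) (u (2 ^ k)) (u 0) := by
      intro k
      induction k with
      | zero => exact fun h => .init ((hfirst _).mpr rfl) (hjoin' h) (hjoin' h)
      | succ k ih =>
        intro hn
        have hpos : 0 < 2 ^ k := by positivity
        have hk : 2 ^ k + (2 ^ k - 1) + 1 = 2 ^ (k + 1) := by rw [pow_succ]; omega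
        have hy : G.Joined (u (2 ^ k - 1)) (u (2 ^ k)) := by
          have := hjoin' (i := 2 ^ k - 1) (by omega)
          rwa [Nat.sub_add_cancel hpos] at this
        have hx : G.Joined (u (2 ^ k + (2 ^ k - 1))) (u (2 ^ (k + 1))) := by
          rw [← hk]
          exact hjoin' (by omega)
        exact .double (complete (ih (by omega)) (2 ^ k - 1) (by omega)) hy hx hx
          ((hfirst _).mpr rfl)
    exact ⟨_, _, _, this k hk.ge, (hfirst _).mpr rfl, (hlast _).mpr (by rw [hk])⟩

/-! ### Linear Datalog -/

section Datalog

variable {V : Type*}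

/-- The atom with given relation symbol and numbered variables. -/
def numberedAtom {S : Type*} {ar : S → ℕ} (var : ℕ ↪ V) (s : S) (l : Fin (ar s) → ℕ)
    (hl : Function.Injective l) : Atom V ar :=
  ⟨s, fun i => var (l i), var.injective.comp hl⟩

/-- The arities of the IDB symbols: a ternary relation and the Boolean output. -/
def powerArity : Fin 2 → ℕ := ![3, 0]

variable (var : ℕ ↪ V) (first last : L)

/-- The head of the rules for the ternary IDB symbol. -/
def headAtom (i j k : ℕ) (h : Function.Injective ![i, j, k]) : Atom V powerArity :=
  numberedAtom var 0 ![i, j, k] h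

theorem safe_headAtom {i j k : ℕ} {h : Function.Injective ![i, j, k]}
    {body : List (Atom V (Sum.elim (GraphRel.arity (L := L)) powerArity))}
    (hi : ∃ b ∈ body, ∃ c, b.args c = var i) (hj : ∃ b ∈ body, ∃ c, b.args c = var j)
    (hk : ∃ b ∈ body, ∃ c, b.args c = var k) :
    ∀ a, ∃ b ∈ body, ∃ c, b.args c = (headAtom var i j k h).args a := by
  have : ∀ a : Fin 3, ∃ b ∈ body, ∃ c, b.args c = var (![i, j, k] a) := by
    intro a
    fin_cases a
    exacts [hi, hj, hk]
  exact this

/-- The atom of the ternary IDB symbol. -/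
def tripleAtom (i j k : ℕ) (h : Function.Injective ![i, j, k]) :
    Atom V (Sum.elim (GraphRel.arity (L := L)) powerArity) :=
  numberedAtom var (.inr 0) ![i, j, k] h

/-- The edge atom. -/
def edgeAtom (i j : ℕ) (h : Function.Injective ![i, j]) :
    Atom V (Sum.elim (GraphRel.arity (L := L)) powerArity) :=
  numberedAtom var (.inl .edge) ![i, j] h

/-- The atom of a node label. -/
def labelAtom (l : L) (i : ℕ) : Atom V (Sum.elim (GraphRel.arity (L := L)) powerArity) :=
  numberedAtom var (.inl (.nodeLabel l)) ![i] (Function.injective_of_subsingleton (α := Fin 1) _)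

/-- The head of the rule for the Boolean output. -/
def outputAtom : Atom V powerArity :=
  numberedAtom var 1 ![] (Function.injective_of_subsingleton (α := Fin 0) _)

/-- The rules of the linear Datalog program for `PowerLength`. -/
def powerRules : List (DatalogRule V (GraphRel.arity (L := L)) powerArity) := [
  { head := headAtom var 1 2 0 (by decide)
    body := [labelAtom var first 0, edgeAtom var 0 1 (by decide), edgeAtom var 0 2 (by decide)]
    safe := safe_headAtom var
      ⟨edgeAtom var 0 1 (by decide), by simp, (1 : Fin 2), rfl⟩
      ⟨edgeAtom var 0 2 (by decide), by simp, (1 : Fin 2), rfl⟩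
      ⟨edgeAtom var 0 1 (by decide), by simp, (0 : Fin 2), rfl⟩ },
  { head := headAtom var 0 3 4 (by decide)
    body := [tripleAtom var 0 1 2 (by decide), edgeAtom var 1 3 (by decide),
      edgeAtom var 2 4 (by decide)]
    safe := safe_headAtom var
      ⟨tripleAtom var 0 1 2 (by decide), by simp, (0 : Fin 3), rfl⟩
      ⟨edgeAtom var 1 3 (by decide), by simp, (1 : Fin 2), rfl⟩
      ⟨edgeAtom var 2 4 (by decide), by simp, (1 : Fin 2), rfl⟩ },
  { head := headAtom var 3 4 5 (by decide)
    body := [tripleAtom var 0 1 2 (by decide), edgeAtom var 2 0 (by decide),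
      edgeAtom var 1 3 (by decide), edgeAtom var 1 4 (by decide), labelAtom var first 5]
    safe := safe_headAtom var
      ⟨edgeAtom var 1 3 (by decide), by simp, (1 : Fin 2), rfl⟩
      ⟨edgeAtom var 1 4 (by decide), by simp, (1 : Fin 2), rfl⟩
      ⟨labelAtom var first 5, by simp, (0 : Fin 1), rfl⟩ },
  { head := outputAtom var
    body := [tripleAtom var 0 1 2 (by decide), labelAtom var first 2, labelAtom var last 0]
    safe := fun (i : Fin 0) => i.elim0 }]

/-- The linear Datalog program for `PowerLength`. -/
def powerProgram : DatalogProgram V (GraphRel.arity (L := L)) :=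
  ⟨2, powerArity, powerRules var first last, 1⟩

/-- The intended IDB instance. -/
def powerInstance (G : PropertyGraph N E L K C) : Database powerArity N
  | 0 => {t : Fin 3 → N | G.Doubling first (t 0) (t 1) (t 2)}
  | 1 => {_t : Fin 0 → N | G.PowerLength first last}

theorem exists_valuation (a : ℕ → N) : ∃ μ : V → N, ∀ i, μ (var i) = a i :=
  ⟨fun x => a (Function.invFun var x), fun i =>
    congrArg a (Function.leftInverse_invFun var.injective i)⟩

theorem holds_labelAtom {G : PropertyGraph N E L K C} {J : Database powerArity N} {μ : V → N}
    {l : L} {i : ℕ} :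
    (labelAtom var l i).Holds (G.database.sum J) μ ↔ G.Labeled l (μ (var i)) :=
  Iff.rfl

theorem holds_edgeAtom {G : PropertyGraph N E L K C} {J : Database powerArity N} {μ : V → N}
    {i j : ℕ} {h : Function.Injective ![i, j]} :
    (edgeAtom var i j h).Holds (G.database.sum J) μ ↔ G.Joined (μ (var i)) (μ (var j)) :=
  Iff.rfl

theorem comp_vec_three (μ : V → N) (i j k : ℕ) :
    (fun a => μ (var (![i, j, k] a))) = ![μ (var i), μ (var j), μ (var k)] := by
  funext a
  fin_cases a <;> rfl

/-- An IDB instance contains a fact of the ternary symbol. -/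
def HoldsTriple (J : Database powerArity N) (a b c : N) : Prop :=
  (![a, b, c] : Fin 3 → N) ∈ J 0

theorem holds_tripleAtom {D : Database (GraphRel.arity (L := L)) N} {J : Database powerArity N}
    {μ : V → N} {i j k : ℕ} {h : Function.Injective ![i, j, k]} :
    (tripleAtom var i j k h).Holds (D.sum J) μ ↔
      HoldsTriple J (μ (var i)) (μ (var j)) (μ (var k)) := by
  rw [HoldsTriple, ← comp_vec_three]
  rfl

theorem holds_headAtom {J : Database powerArity N}
    {μ : V → N} {i j k : ℕ} {h : Function.Injective ![i, j, k]} :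
    (headAtom var i j k h).Holds J μ ↔
      HoldsTriple J (μ (var i)) (μ (var j)) (μ (var k)) := by
  rw [HoldsTriple, ← comp_vec_three]
  rfl

theorem satisfies_powerProgram {G : PropertyGraph N E L K C} {J : Database powerArity N} :
    (powerProgram var first last).Satisfies G.database J ↔
      (∀ μ : V → N, G.Labeled first (μ (var 0)) ∧ G.Joined (μ (var 0)) (μ (var 1)) ∧
        G.Joined (μ (var 0)) (μ (var 2)) → HoldsTriple J (μ (var 1)) (μ (var 2)) (μ (var 0))) ∧
      (∀ μ : V → N, HoldsTriple J (μ (var 0)) (μ (var 1)) (μ (var 2)) ∧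
        G.Joined (μ (var 1)) (μ (var 3)) ∧ G.Joined (μ (var 2)) (μ (var 4)) →
          HoldsTriple J (μ (var 0)) (μ (var 3)) (μ (var 4))) ∧
      (∀ μ : V → N, HoldsTriple J (μ (var 0)) (μ (var 1)) (μ (var 2)) ∧
        G.Joined (μ (var 2)) (μ (var 0)) ∧ G.Joined (μ (var 1)) (μ (var 3)) ∧
        G.Joined (μ (var 1)) (μ (var 4)) ∧ G.Labeled first (μ (var 5)) →
          HoldsTriple J (μ (var 3)) (μ (var 4)) (μ (var 5))) ∧
      (∀ μ : V → N, HoldsTriple J (μ (var 0)) (μ (var 1)) (μ (var 2)) ∧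
        G.Labeled first (μ (var 2)) ∧ G.Labeled last (μ (var 0)) →
          (outputAtom var).Holds J μ) := by
  show (∀ ρ ∈ powerRules var first last, ∀ μ : V → N,
    (∀ b ∈ ρ.body, b.Holds (G.database.sum J) μ) → ρ.head.Holds J μ) ↔ _
  simp only [powerRules, List.mem_cons, List.not_mem_nil, or_false,
    forall_eq_or_imp, forall_eq, holds_labelAtom, holds_edgeAtom, holds_tripleAtom,
    holds_headAtom]

theorem powerInstance_satisfies (G : PropertyGraph N E L K C) :
    (powerProgram var first last).Satisfies G.database (powerInstance first last G) :=
  (satisfies_powerProgram var first last).mpr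
    ⟨fun _ h => .init h.1 h.2.1 h.2.2, fun _ h => .move h.1 h.2.1 h.2.2,
      fun _ h => .double h.1 h.2.1 h.2.2.1 h.2.2.2.1 h.2.2.2.2,
      fun _ h => ⟨_, _, _, h.1, h.2.1, h.2.2⟩⟩

variable {first last} in
theorem mem_of_doubling {G : PropertyGraph N E L K C} {J : Database powerArity N}
    (hJ : (powerProgram var first last).Satisfies G.database J) {p x y : N}
    (h : G.Doubling first p x y) : HoldsTriple J p x y := by
  obtain ⟨h1, h2, h3, -⟩ := (satisfies_powerProgram var first last).mp hJ
  induction h with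
  | @init z x x' hz hx hx' =>
    obtain ⟨μ, hμ⟩ := exists_valuation var fun i => [z, x, x'].getD i z
    have := h1 μ
    simp only [hμ] at this
    exact this ⟨hz, hx, hx'⟩
  | @move p x y x' y' _ hx hy ih =>
    obtain ⟨μ, hμ⟩ := exists_valuation var fun i => [p, x, y, x', y'].getD i p
    have := h2 μ
    simp only [hμ] at this
    exact this ⟨ih, hx, hy⟩
  | @double p x y x' x'' z _ hy hx hx' hz ih =>
    obtain ⟨μ, hμ⟩ := exists_valuation var fun i => [p, x, y, x', x'', z].getD i p
    have := h3 μ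
    simp only [hμ] at this
    exact this ⟨ih, hy, hx, hx', hz⟩

theorem expressibleLinearDatalog_powerLength [Infinite V] :
    ExpressibleLinearDatalog V (PropertyGraph.PowerLength first last :
      PropertyGraph N E L K C → Prop) := by
  let var : ℕ ↪ V := Infinite.natEmbedding V
  refine ⟨powerProgram var first last, ?_, rfl, fun G => ⟨?_, ?_⟩⟩
  · show ∀ ρ ∈ powerRules var first last, ρ.body.countP (fun b => b.rel.isRight) ≤ 1
    simp only [powerRules, List.mem_cons, List.not_mem_nil, or_false, forall_eq_or_imp, forall_eq]
    exact ⟨Nat.zero_le 1, le_of_eq rfl, le_of_eq rfl, le_of_eq rfl⟩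
  · rintro ⟨p, x, z, h, hz, hp⟩
    refine ⟨(Fin.elim0 : Fin 0 → N), fun J hJ => ?_⟩
    have hmem := mem_of_doubling var hJ h
    obtain ⟨-, -, -, h4⟩ := (satisfies_powerProgram var first last).mp hJ
    obtain ⟨μ, hμ⟩ := exists_valuation var fun i => [p, x, z].getD i p
    have := h4 μ
    simp only [hμ] at this
    have helim : (Fin.elim0 : Fin 0 → N) = fun i => μ ((outputAtom var).args i) :=
      Subsingleton.elim _ _
    show (Fin.elim0 : Fin 0 → N) ∈ (J (1 : Fin 2) : Set (Fin 0 → N))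
    rw [helim]
    exact this ⟨hmem, hz, hp⟩
  · rintro ⟨t, ht⟩
    exact ht _ (powerInstance_satisfies var first last G)

end Datalog

/-! ### Positive recursive SQL -/

section SQL

variable (first last : L)

/-- The block for the starting triples. -/
def initBlock : SelectBlock (extArity (GraphRel.arity (L := L)) 3) 3 where
  numFrom := 3
  numFrom_pos := by norm_num
  tables := ![some (.nodeLabel first), some .edge, some .edge]
  conds := [(⟨0, (0 : Fin 1)⟩, ⟨1, (0 : Fin 2)⟩), (⟨0, (0 : Fin 1)⟩, ⟨2, (0 : Fin 2)⟩)]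
  cols := ![⟨1, (1 : Fin 2)⟩, ⟨2, (1 : Fin 2)⟩, ⟨0, (0 : Fin 1)⟩]

/-- The block that moves two components in parallel. -/
def moveBlock : SelectBlock (extArity (GraphRel.arity (L := L)) 3) 3 where
  numFrom := 3
  numFrom_pos := by norm_num
  tables := ![none, some .edge, some .edge]
  conds := [(⟨0, (1 : Fin 3)⟩, ⟨1, (0 : Fin 2)⟩), (⟨0, (2 : Fin 3)⟩, ⟨2, (0 : Fin 2)⟩)]
  cols := ![⟨0, (0 : Fin 3)⟩, ⟨1, (1 : Fin 2)⟩, ⟨2, (1 : Fin 2)⟩]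

/-- The block that doubles the length. -/
def doubleBlock : SelectBlock (extArity (GraphRel.arity (L := L)) 3) 3 where
  numFrom := 5
  numFrom_pos := by norm_num
  tables := ![none, some .edge, some .edge, some .edge, some (.nodeLabel first)]
  conds := [(⟨0, (2 : Fin 3)⟩, ⟨1, (0 : Fin 2)⟩), (⟨0, (0 : Fin 3)⟩, ⟨1, (1 : Fin 2)⟩),
    (⟨0, (1 : Fin 3)⟩, ⟨2, (0 : Fin 2)⟩), (⟨0, (1 : Fin 3)⟩, ⟨3, (0 : Fin 2)⟩)]
  cols := ![⟨2, (1 : Fin 2)⟩, ⟨3, (1 : Fin 2)⟩, ⟨4, (0 : Fin 1)⟩]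

/-- The block of the main query. -/
def outputBlock : SelectBlock (extArity (GraphRel.arity (L := L)) 3) 1 where
  numFrom := 3
  numFrom_pos := by norm_num
  tables := ![none, some (.nodeLabel first), some (.nodeLabel last)]
  conds := [(⟨0, (2 : Fin 3)⟩, ⟨1, (0 : Fin 1)⟩), (⟨0, (0 : Fin 3)⟩, ⟨2, (0 : Fin 1)⟩)]
  cols := ![⟨0, (0 : Fin 3)⟩]

/-- The positive recursive SQL query for `PowerLength`. -/
def powerSQL : RecSQL 1 (GraphRel.arity (L := L)) :=
  .withRec 3 (by norm_num) [initBlock first, moveBlock, doubleBlock first]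
    (by
      intro b hb i j hi hj
      simp only [List.mem_cons, List.not_mem_nil, or_false] at hb
      rcases hb with rfl | rfl | rfl
      · change Fin 3 at i j
        fin_cases i <;> fin_cases j <;> first
          | rfl
          | exact absurd hi (Option.some_ne_none _)
      · change Fin 3 at i j
        fin_cases i <;> fin_cases j <;> first
          | rfl
          | exact absurd hi (Option.some_ne_none _)
          | exact absurd hj (Option.some_ne_none _)
      · change Fin 5 at i j
        fin_cases i <;> fin_cases j <;> first
          | rfl
          | exact absurd hi (Option.some_ne_none _)
          | exact absurd hj (Option.some_ne_none _))
    (.main [outputBlock first last])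

variable {G : PropertyGraph N E L K C} {R : Set (Fin 3 → N)}

theorem mem_eval_initBlock {t : Fin 3 → N} :
    t ∈ (initBlock first).eval (G.database.ext R) ↔
      G.Labeled first (t 2) ∧ G.Joined (t 2) (t 0) ∧ G.Joined (t 2) (t 1) := by
  constructor
  · rintro ⟨row, hrow, hcond, hcol⟩
    have r0 : G.Labeled first _ := hrow (0 : Fin 3)
    have r1 : G.Joined _ _ := hrow (1 : Fin 3)
    have r2 : G.Joined _ _ := hrow (2 : Fin 3)
    obtain ⟨c1, hcond⟩ := List.forall_mem_cons.mp hcond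
    obtain ⟨c2, -⟩ := List.forall_mem_cons.mp hcond
    refine ⟨(hcol 2).symm ▸ r0, ?_, ?_⟩
    · exact (hcol 2).symm ▸ (hcol 0).symm ▸ c1.symm ▸ r1
    · exact (hcol 2).symm ▸ (hcol 1).symm ▸ c2.symm ▸ r2
  · rintro ⟨hz, hx, hx'⟩
    refine ⟨fun (i : Fin 3) => match i with
      | 0 => fun _ => t 2
      | 1 => (![t 2, t 0] : Fin 2 → N)
      | 2 => (![t 2, t 1] : Fin 2 → N), fun (i : Fin 3) => ?_,
      List.forall_mem_cons.mpr ⟨rfl, List.forall_mem_cons.mpr ⟨rfl, List.forall_mem_nil _⟩⟩,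
      fun j => ?_⟩
    · fin_cases i
      exacts [hz, hx, hx']
    · fin_cases j <;> rfl

theorem mem_eval_moveBlock {t : Fin 3 → N} :
    t ∈ moveBlock.eval (G.database.ext R) ↔
      ∃ s ∈ R, t 0 = s 0 ∧ G.Joined (s 1) (t 1) ∧ G.Joined (s 2) (t 2) := by
  constructor
  · rintro ⟨row, hrow, hcond, hcol⟩
    have r1 : G.Joined _ _ := hrow (1 : Fin 3)
    have r2 : G.Joined _ _ := hrow (2 : Fin 3)
    obtain ⟨c1, hcond⟩ := List.forall_mem_cons.mp hcond
    obtain ⟨c2, -⟩ := List.forall_mem_cons.mp hcond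
    refine ⟨row (0 : Fin 3), hrow (0 : Fin 3), hcol 0, ?_, ?_⟩
    · exact (hcol 1).symm ▸ c1.symm ▸ r1
    · exact (hcol 2).symm ▸ c2.symm ▸ r2
  · rintro ⟨s, hs, h0, hx, hy⟩
    refine ⟨fun (i : Fin 3) => match i with
      | 0 => s
      | 1 => (![s 1, t 1] : Fin 2 → N)
      | 2 => (![s 2, t 2] : Fin 2 → N), fun (i : Fin 3) => ?_,
      List.forall_mem_cons.mpr ⟨rfl, List.forall_mem_cons.mpr ⟨rfl, List.forall_mem_nil _⟩⟩,
      fun j => ?_⟩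
    · fin_cases i
      exacts [hs, hx, hy]
    · fin_cases j
      exacts [h0, rfl, rfl]

theorem mem_eval_doubleBlock {t : Fin 3 → N} :
    t ∈ (doubleBlock first).eval (G.database.ext R) ↔
      ∃ s ∈ R, G.Joined (s 2) (s 0) ∧ G.Joined (s 1) (t 0) ∧ G.Joined (s 1) (t 1) ∧
        G.Labeled first (t 2) := by
  constructor
  · rintro ⟨row, hrow, hcond, hcol⟩
    have r1 : G.Joined _ _ := hrow (1 : Fin 5)
    have r2 : G.Joined _ _ := hrow (2 : Fin 5)
    have r3 : G.Joined _ _ := hrow (3 : Fin 5)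
    have r4 : G.Labeled first _ := hrow (4 : Fin 5)
    obtain ⟨c1, hcond⟩ := List.forall_mem_cons.mp hcond
    obtain ⟨c2, hcond⟩ := List.forall_mem_cons.mp hcond
    obtain ⟨c3, hcond⟩ := List.forall_mem_cons.mp hcond
    obtain ⟨c4, -⟩ := List.forall_mem_cons.mp hcond
    refine ⟨row (0 : Fin 5), hrow (0 : Fin 5), ?_, ?_, ?_, (hcol 2).symm ▸ r4⟩
    · exact c1.symm ▸ c2.symm ▸ r1
    · exact (hcol 0).symm ▸ c3.symm ▸ r2
    · exact (hcol 1).symm ▸ c4.symm ▸ r3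
  · rintro ⟨s, hs, hy, hx, hx', hz⟩
    refine ⟨fun (i : Fin 5) => match i with
      | 0 => s
      | 1 => (![s 2, s 0] : Fin 2 → N)
      | 2 => (![s 1, t 0] : Fin 2 → N)
      | 3 => (![s 1, t 1] : Fin 2 → N)
      | 4 => fun _ => t 2, fun (i : Fin 5) => ?_,
      List.forall_mem_cons.mpr ⟨rfl, List.forall_mem_cons.mpr ⟨rfl,
        List.forall_mem_cons.mpr ⟨rfl, List.forall_mem_cons.mpr ⟨rfl, List.forall_mem_nil _⟩⟩⟩⟩,
      fun j => ?_⟩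
    · fin_cases i
      exacts [hs, hy, hx, hx', hz]
    · fin_cases j <;> rfl

theorem mem_eval_outputBlock {t : Fin 1 → N} :
    t ∈ (outputBlock first last).eval (G.database.ext R) ↔
      ∃ s ∈ R, t 0 = s 0 ∧ G.Labeled first (s 2) ∧ G.Labeled last (s 0) := by
  constructor
  · rintro ⟨row, hrow, hcond, hcol⟩
    have r1 : G.Labeled first _ := hrow (1 : Fin 3)
    have r2 : G.Labeled last _ := hrow (2 : Fin 3)
    obtain ⟨c1, hcond⟩ := List.forall_mem_cons.mp hcond
    obtain ⟨c2, -⟩ := List.forall_mem_cons.mp hcond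
    exact ⟨row (0 : Fin 3), hrow (0 : Fin 3), hcol 0, c1.symm ▸ r1, c2.symm ▸ r2⟩
  · rintro ⟨s, hs, h0, hz, hp⟩
    refine ⟨fun (i : Fin 3) => match i with
      | 0 => s
      | 1 => fun _ => s 2
      | 2 => fun _ => s 0, fun (i : Fin 3) => ?_,
      List.forall_mem_cons.mpr ⟨rfl, List.forall_mem_cons.mpr ⟨rfl, List.forall_mem_nil _⟩⟩,
      fun j => ?_⟩
    · fin_cases i
      exacts [hs, hz, hp]
    · fin_cases j
      exact h0

theorem recTable_eq : recTable G.database [initBlock first, moveBlock, doubleBlock first] =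
    {t | G.Doubling first (t 0) (t 1) (t 2)} := by
  refine subset_antisymm (Set.sInter_subset_of_mem ?_) (Set.subset_sInter ?_)
  · rintro t ⟨b, hb, ht⟩
    simp only [List.mem_cons, List.not_mem_nil, or_false] at hb
    rcases hb with rfl | rfl | rfl
    · obtain ⟨hz, hx, hx'⟩ := (mem_eval_initBlock first).mp ht
      exact .init hz hx hx'
    · obtain ⟨s, hs, h0, hx, hy⟩ := mem_eval_moveBlock.mp ht
      exact .move (h0.symm ▸ hs) hx hy
    · obtain ⟨s, hs, hy, hx, hx', hz⟩ := (mem_eval_doubleBlock first).mp ht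
      exact .double hs hy hx hx' hz
  · intro R hR
    have key : ∀ {p x y}, G.Doubling first p x y →
        ∀ t : Fin 3 → N, t 0 = p → t 1 = x → t 2 = y → t ∈ R := by
      intro p x y h
      induction h with
      | init hz hx hx' =>
        rintro t rfl rfl rfl
        exact hR ⟨_, by simp, (mem_eval_initBlock first).mpr ⟨hz, hx, hx'⟩⟩
      | @move p x y x' y' _ hx hy ih =>
        rintro t rfl rfl rfl
        exact hR ⟨_, List.mem_cons_of_mem _ (List.mem_cons_self ..),
          mem_eval_moveBlock.mpr ⟨![t 0, x, y], ih _ rfl rfl rfl, rfl, hx, hy⟩⟩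
      | @double p x y x' x'' z _ hy hx hx' hz ih =>
        rintro t rfl rfl rfl
        exact hR ⟨doubleBlock first, by simp,
          (mem_eval_doubleBlock first).mpr ⟨![p, x, y], ih _ rfl rfl rfl, hy, hx, hx', hz⟩⟩
    exact fun t ht => key ht t rfl rfl rfl

theorem expressibleRecSQL_powerLength :
    ExpressibleRecSQL (PropertyGraph.PowerLength first last : PropertyGraph N E L K C → Prop) := by
  refine ⟨1, Nat.one_pos, powerSQL first last, fun G => ?_⟩
  have heval : (powerSQL first last).eval G.database =
      unionEval (G.database.ext (recTable G.database
        [initBlock first, moveBlock, doubleBlock first])) [outputBlock first last] := by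
    simp only [powerSQL, RecSQL.eval]
  rw [heval, recTable_eq]
  constructor
  · rintro ⟨p, x, z, h, hz, hp⟩
    exact ⟨fun _ => p, _, List.mem_cons_self .., (mem_eval_outputBlock first last).mpr
      ⟨![p, x, z], h, rfl, hz, hp⟩⟩
  · rintro ⟨t, b, hb, ht⟩
    obtain rfl := List.mem_singleton.mp hb
    obtain ⟨s, hs, -, hz, hp⟩ := (mem_eval_outputBlock first last).mp ht
    exact ⟨_, _, _, hs, hz, hp⟩

end SQL

end PowerQuery

end

end GraphQL

theorem mainTheorem7 {N E L K C V : Type*} [Infinite N] [Infinite E] [Infinite V] [LinearOrder C]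
    (first last : L) (hfl : first ≠ last) :
    -- a separating query: on dataless paths it asks whether the length is a power of 2
    (∃ q : GraphQL.PropertyGraph N E L K C → Prop,
      (∀ n G, GraphQL.IsDatalessPath first last n G → (q G ↔ ∃ k : ℕ, n = 2 ^ k)) ∧
      GraphQL.ExpressibleRecSQL q ∧
      GraphQL.ExpressibleLinearDatalog V q ∧
      ¬ GraphQL.ExpressibleCoreGQL V q ∧
      ¬ GraphQL.ExpressibleCorePGQ V q) ∧
    -- no Core GQL or Core PGQ query decides on dataless paths whether the length is a power of 2
    (¬ ∃ Q : GraphQL.CoreGQL V L K, GraphQL.DefinesLengths first last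
      (fun G : GraphQL.PropertyGraph N E L K C => (Q.result G).Nonempty) {n | ∃ k : ℕ, n = 2 ^ k}) ∧
    (¬ ∃ Q : GraphQL.CorePGQ V L K, GraphQL.DefinesLengths first last
      (fun G : GraphQL.PropertyGraph N E L K C => (Q.result G).Nonempty) {n | ∃ k : ℕ, n = 2 ^ k}) ∧
    -- the definable sets of lengths are Presburger definable, semilinear and ultimately periodic
    (∀ Q : GraphQL.CoreGQL V L K, ∃ A : Set ℕ, GraphQL.DefinesLengths first last
      (fun G : GraphQL.PropertyGraph N E L K C => (Q.result G).Nonempty) A ∧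
      (∅ : Set ℕ).Definable₁ FirstOrder.Language.presburger A ∧
      IsSemilinearSet A ∧ GraphQL.UltimatelyPeriodic A) ∧
    (∀ Q : GraphQL.CorePGQ V L K, ∃ A : Set ℕ, GraphQL.DefinesLengths first last
      (fun G : GraphQL.PropertyGraph N E L K C => (Q.result G).Nonempty) A ∧
      (∅ : Set ℕ).Definable₁ FirstOrder.Language.presburger A ∧
      IsSemilinearSet A ∧ GraphQL.UltimatelyPeriodic A) := by
  have hGQL : ∀ Q : GraphQL.CoreGQL V L K, ¬ GraphQL.DefinesLengths first last
      (fun G : GraphQL.PropertyGraph N E L K C => (Q.result G).Nonempty)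
      {n | ∃ k : ℕ, n = 2 ^ k} := fun Q =>
    GraphQL.not_definesLengths_powers (GraphQL.CoreGQL.exists_lengths first last Q)
  have hPGQ : ∀ Q : GraphQL.CorePGQ V L K, ¬ GraphQL.DefinesLengths first last
      (fun G : GraphQL.PropertyGraph N E L K C => (Q.result G).Nonempty)
      {n | ∃ k : ℕ, n = 2 ^ k} := fun Q =>
    GraphQL.not_definesLengths_powers (GraphQL.CorePGQ.exists_lengths first last Q)
  refine ⟨⟨GraphQL.PropertyGraph.PowerLength first last, fun n G hG =>
    GraphQL.powerLength_iff hfl hG, GraphQL.expressibleRecSQL_powerLength first last,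
    GraphQL.expressibleLinearDatalog_powerLength first last, ?_, ?_⟩,
    fun ⟨Q, hQ⟩ => hGQL Q hQ, fun ⟨Q, hQ⟩ => hPGQ Q hQ,
    GraphQL.CoreGQL.exists_lengths first last, GraphQL.CorePGQ.exists_lengths first last⟩
  · rintro ⟨Q, hQ⟩
    exact hGQL Q fun n _ G hG => (hQ G).symm.trans (GraphQL.powerLength_iff hfl hG)
  · rintro ⟨Q, hQ⟩
    exact hPGQ Q fun n _ G hG => (hQ G).symm.trans (GraphQL.powerLength_iff hfl hG)
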